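/- Let $N\ge 3$, $0\le\mu\le (N-2)^2/8$, $2^*=\frac{2N}{N-2}$, $p=2^*-1$, $\beta=\frac{N-2}{4}=\frac1{p-1}$ and $K(y)=e^{|y|^2/4}$ on $\mathbb{R}^N$. Let $L^2_K$ be the space of measurable functions with $\|v\|_{K,2}^2=\int_{\mathbb{R}^N}|v|^2K\,dy<\infty$, with inner product $(f,g)_K=\int fg\,K\,dy$ (and likewise for vector fields), and let $X\subset L^2_K$ be the completion of $C_c^\infty(\mathbb{R}^N)$ for the norm $\|\nabla v\|_{K,2}$. For $v\in X$ put $$A(v)=\int_{\mathbb{R}^N}\Big(|\nabla v|^2-\mu\frac{|v|^2}{|y|^2}-\beta|v|^2\Big)K\,dy,\qquad B(v)=\int_{\mathbb{R}^N}|v|^{2^*}K\,dy,$$ $$E_K(v)=\tfrac12A(v)-\tfrac1{2^*}B(v),\qquad D_K(v)=A(v)-B(v),\qquad d=\inf\{E_K(v): v\in X\setminus\{0\},\ D_K(v)=0\}.$$ Consider the problem $$v_s-\Delta v-\tfrac12\,y\cdot\nabla v=\beta v+\mu\frac{v}{|y|^2}+|v|^{p-1}v\ \text{ in }\mathbb{R}^N\times(0,T),\qquad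 v|_{s=0}=v_0 .\tag{P}$$ For $0<T<\infty$ and $v_0\in X$, a weak solution of (P) on $(0,T)$ is a function $v\in C([0,T);X)\cap L^\infty(0,T;X)$ with $v(0)=v_0$ and $v_s\in L^2(0,T;L^2_K)$ such that for all $w\in X$ and $s\in(0,T)$ $$\int_0^s\big[(v_s,w)_K+(\nabla v,\nabla w)_K\big]\,d\tau=\int_0^s\Big(|v|^{p-1}v+\mu\frac{v}{|y|^2}+\frac{v}{p-1},\,w\Big)_K\,d\tau .$$ The maximal existence time of a weak solution $v$ is the supremum of all $T'>0$ such that some weak solution of (P) on $(0,T')$ with the same initial value agrees with $v$ on the common time interval. **Theorem (blow-up at critical energy).** If $v_0\in X$, $E_K(v_0)=d$ and $D_K(v_0)<0$, then the maximal existence time of every weak solution of (P) with initial value $v_0$ is finite. -/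

import Mathlib

open MeasureTheory Set
open scoped ENNReal ContDiff

noncomputable section

namespace HardyHeat

/-- The Euclidean space `ℝ^N`. -/
abbrev E (N : ℕ) : Type := EuclideanSpace ℝ (Fin N)

/-- The weight `K(y) = exp (|y|² / 4)`. -/
def K {N : ℕ} (y : E N) : ℝ := Real.exp (‖y‖ ^ 2 / 4)

/-- The measure `K(y) dy`. -/
def wMeasure (N : ℕ) : Measure (E N) :=
  (volume : Measure (E N)).withDensity fun y => ENNReal.ofReal (K y)

/-- The weighted space `L²_K(ℝ^N)`. Its inner product is `∫ f g K dy`. -/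
abbrev L2K (N : ℕ) : Type := Lp ℝ 2 (wMeasure N)

/-- The weighted space `L²_K(ℝ^N; ℝ^N)` of vector fields. -/
abbrev L2KVec (N : ℕ) : Type := Lp (E N) 2 (wMeasure N)

/-- The pairs `(φ, ∇φ)` with `φ ∈ C_c^∞(ℝ^N)`, inside `L²_K × L²_K`. -/
def testPairs (N : ℕ) : Submodule ℝ (L2K N × L2KVec N) where
  carrier := {z | ∃ φ : E N → ℝ, ContDiff ℝ ∞ φ ∧ HasCompactSupport φ ∧
    z.1 =ᵐ[wMeasure N] φ ∧ z.2 =ᵐ[wMeasure N] gradient φ}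
  add_mem' := by
    rintro a b ⟨φ, hφ, hφc, h1, h2⟩ ⟨ψ, hψ, hψc, k1, k2⟩
    refine ⟨φ + ψ, hφ.add hψ, hφc.add hψc, ?_, ?_⟩
    · exact (Lp.coeFn_add a.1 b.1).trans (h1.add k1)
    · refine ((Lp.coeFn_add a.2 b.2).trans (h2.add k2)).trans (Filter.Eventually.of_forall ?_)
      intro x
      have hφd : DifferentiableAt ℝ φ x := (hφ.differentiable (by simp)) x
      have hψd : DifferentiableAt ℝ ψ x := (hψ.differentiable (by simp)) x
      simp [gradient, fderiv_add hφd hψd]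
  zero_mem' := by
    refine ⟨0, contDiff_const, HasCompactSupport.zero, Lp.coeFn_zero _ _ _, ?_⟩
    refine (Lp.coeFn_zero _ _ _).trans (Filter.Eventually.of_forall ?_)
    intro x
    simp [gradient]
  smul_mem' := by
    rintro c a ⟨φ, hφ, hφc, h1, h2⟩
    refine ⟨c • φ, hφ.const_smul c, hφc.smul_left (f := fun _ => c), ?_, ?_⟩
    · exact (Lp.coeFn_smul c a.1).trans (h1.const_smul c)
    · refine ((Lp.coeFn_smul c a.2).trans (h2.const_smul c)).trans
        (Filter.Eventually.of_forall ?_)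
      intro x
      have hφd : DifferentiableAt ℝ φ x := (hφ.differentiable (by simp)) x
      simp [gradient, fderiv_const_smul hφd]

/-- The space `X`: the completion of `C_c^∞(ℝ^N)` for the norm `‖∇v‖_{K,2}`. Because of the
Poincaré inequality `(N/2) ‖φ‖_{K,2}² ≤ ‖∇φ‖_{K,2}²`, it is realized as the closure of the pairs
`(φ, ∇φ)` in `L²_K × L²_K`; an element is a function `v ∈ L²_K` together with its weak gradient,
which `v` determines. The norm of `X` is always written out as the norm of `grad v` below. -/
abbrev X (N : ℕ) : Type := ↥(testPairs N).topologicalClosure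

/-- The element of `L²_K` underlying `v ∈ X`. -/
def fn {N : ℕ} (v : X N) : L2K N := v.1.1

/-- The weak gradient `∇v ∈ L²_K` of `v ∈ X`; the norm of `v` in `X` is `‖grad v‖`. -/
def grad {N : ℕ} (v : X N) : L2KVec N := v.1.2

/-- The critical Sobolev exponent `2* = 2N / (N - 2)`. -/
def twoStar (N : ℕ) : ℝ := 2 * N / ((N : ℝ) - 2)

/-- The exponent `p = 2* - 1`. -/
def pExp (N : ℕ) : ℝ := twoStar N - 1

/-- The constant `β = (N - 2) / 4`, which equals `1 / (p - 1)`. -/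
def beta (N : ℕ) : ℝ := ((N : ℝ) - 2) / 4

/-- `A(v) = ∫ (|∇v|² - μ |v|² / |y|² - β |v|²) K dy`. -/
def A (N : ℕ) (μ : ℝ) (v : X N) : ℝ :=
  ∫ y, (‖grad v y‖ ^ 2 - μ * (|fn v y| ^ 2 / ‖y‖ ^ 2) - beta N * |fn v y| ^ 2) ∂(wMeasure N)

/-- `B(v) = ∫ |v|^{2*} K dy`. -/
def B (N : ℕ) (v : X N) : ℝ := ∫ y, |fn v y| ^ twoStar N ∂(wMeasure N)

/-- The energy `E_K(v) = A(v) / 2 - B(v) / 2*`. -/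
def energy (N : ℕ) (μ : ℝ) (v : X N) : ℝ := 1 / 2 * A N μ v - 1 / twoStar N * B N v

/-- The Nehari functional `D_K(v) = A(v) - B(v)`. -/
def nehari (N : ℕ) (μ : ℝ) (v : X N) : ℝ := A N μ v - B N v

/-- The Nehari manifold `{v ∈ X : D_K(v) = 0, v ≠ 0}`. -/
def nehariManifold (N : ℕ) (μ : ℝ) : Set (X N) := {v | nehari N μ v = 0 ∧ v ≠ 0}

/-- The depth of the potential well, `d = inf E_K` over the Nehari manifold. -/
def depth (N : ℕ) (μ : ℝ) : ℝ := sInf (energy N μ '' nehariManifold N μ)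

/-- `v` is a weak solution on `ℝ^N × (0, T)` of
`v_s - Δv - (1/2) y · ∇v = β v + μ v / |y|² + |v|^{p-1} v`, `v(0) = v₀`:
`v ∈ C([0, T); X) ∩ L^∞(0, T; X)`, `v` has a time derivative `v_s ∈ L²(0, T; L²_K)`
(that is, `v` is the primitive of `v_s`), and the equation holds when tested with every `w ∈ X` and
integrated over `(0, s)`. -/
structure IsWeakSolution (N : ℕ) (μ : ℝ) (v₀ : X N) (v : ℝ → X N) (T : ℝ) : Prop where
  pos : 0 < T
  initial : v 0 = v₀
  continuousOn : ContinuousOn (fun s => grad (v s)) (Ico 0 T)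
  memLp_top : MemLp (fun s => grad (v s)) ∞ (volume.restrict (Ioo 0 T))
  equation : ∃ vs : ℝ → L2K N,
    MemLp vs 2 (volume.restrict (Ioo 0 T)) ∧
    (∀ s ∈ Ico 0 T, fn (v s) = fn v₀ + ∫ τ in (0 : ℝ)..s, vs τ) ∧
    ∀ w : X N, ∀ s ∈ Ioo 0 T,
      (∫ τ in (0 : ℝ)..s, (inner ℝ (vs τ) (fn w) + inner ℝ (grad (v τ)) (grad w))) =
      ∫ τ in (0 : ℝ)..s, ∫ y,
        (|fn (v τ) y| ^ (pExp N - 1) * fn (v τ) y + μ * (fn (v τ) y / ‖y‖ ^ 2)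
          + fn (v τ) y / (pExp N - 1)) * fn w y ∂(wMeasure N)

/-- The maximal existence time of a weak solution `v` given on `(0, T)`: the supremum of all `T'`
such that a weak solution on `(0, T')` agrees with `v` as long as both are given. -/
def maximalExistenceTime (N : ℕ) (μ : ℝ) (v₀ : X N) (v : ℝ → X N) (T : ℝ) : ℝ≥0∞ :=
  ⨆ (T' : ℝ) (_ : ∃ v' : ℝ → X N,
    IsWeakSolution N μ v₀ v' T' ∧ EqOn v' v (Ico 0 (min T T'))), ENNReal.ofReal T'

end HardyHeat

end

/-! Write `q` for `2*`, `m` for the squared `L²_K` norm of `v`, `e` for the energy and `D` for the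
Nehari functional along a solution. The problem is the gradient flow of the energy in `L²_K`.
Testing with `v` gives `m' = -2 D`, the energy identity gives that `e` decreases at rate `‖v_s‖²`,
and Cauchy–Schwarz gives `‖v_s‖² ≥ D² / m`.

The variational input is `nehari_le_of_neg`: a `v` with `D(v) < 0` is brought onto the Nehari
manifold by a factor at most `1`, whence `d ≤ (1/2 - 1/q) A(v)`, that is, `D ≤ q (e - d)`. At `e =
d` this yields no gap, but dissipation is strict while `D < 0`, so the energy drops below `d` at
once. The same inequality then prevents `D` from returning to zero (`OutsideWell.neg`).

From a time `s > 0` on, `G = 2q (d - e)` is positive, `m' ≥ G`, and formally `G' ≥ 2q D² / m = (q/2)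
(m')² / m ≥ (q/2) (m'/m) G`. Thus `G m^(-q/2)` is nondecreasing and `m' ≥ const · m^(q/2)` with `q/2
> 1`, so the solution cannot live beyond `s + m(s) / ((q/2 - 1) G(s))` (`OutsideWell.sub_mul_le`).
The bound involves the solution only through `v(s)`, so it serves every extension at once.

The analytic difficulty is the energy identity: `v_s` is only in `L²_K`, hence not an admissible
test function, and the nonlinearity is critical. `energy_identity` uses difference quotients. The
quadratic part and the convex part of the energy are compared between two times
(`abs_Φ_sub_add_inner_le`), and the error is absorbed by coercivity, because the potential
`|v|^(q-2)` is form-small up to an `L²_K` term, uniformly on compact sets of `X`. Coercivity and the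
embeddings come from Poincaré, Hardy and Sobolev inequalities with the weight `K`. -/

noncomputable section

namespace HardyHeat

/-! ### The critical power nonlinearity on `L^q`. -/

section PowerNonlinearity

open Filter Topology

/-- Bernoulli's inequality with exponent `r + 1` at `a / b`. The factor `a` matters: for `r < 1` the
function `t ↦ t^r` is not Lipschitz near `0`. -/
lemma rpow_mul_sub_le {r : ℝ} (hr : 0 < r) {a b : ℝ} (ha : 0 ≤ a) (hab : a ≤ b) :
    (b ^ r - a ^ r) * a ≤ (r + 1) * b ^ r * (b - a) := by
  rcases eq_or_lt_of_le (ha.trans hab) with h0 | hb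
  · have : a = 0 := le_antisymm (h0 ▸ hab) ha
    subst this; subst h0; simp
  have h1 : 1 + (r + 1) * (a / b - 1) ≤ (1 + (a / b - 1)) ^ (r + 1) :=
    one_add_mul_self_le_rpow_one_add (by have := div_nonneg ha hb.le; linarith) (by linarith)
  have h2 : (1 + (a / b - 1)) ^ (r + 1) = a ^ (r + 1) / b ^ (r + 1) := by
    rw [add_sub_cancel, Real.div_rpow ha hb.le]
  have hbp : 0 < b ^ (r + 1) := Real.rpow_pos_of_pos hb _
  rw [h2, le_div_iff₀ hbp] at h1
  have hb1 : b ^ (r + 1) = b ^ r * b := Real.rpow_add_one hb.ne' r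
  have ha1 : a ^ (r + 1) = a ^ r * a := by
    rcases eq_or_lt_of_le ha with h | h
    · subst h; simp [Real.zero_rpow (by linarith : r + 1 ≠ 0)]
    · exact Real.rpow_add_one h.ne' r
  have h3 : (1 + (r + 1) * (a / b - 1)) * b ^ (r + 1) = b ^ r * b - (r + 1) * b ^ r * (b - a) := by
    rw [hb1]; field_simp; ring
  have hbr : 0 ≤ b ^ r := Real.rpow_nonneg hb.le r
  have := mul_le_mul_of_nonneg_left hab hbr
  rw [h3, ha1] at h1
  nlinarith

/-- The map `t ↦ |t|^r t` is locally Lipschitz, with constant comparable to `|t|^r`. -/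
lemma abs_rpow_mul_sub_le {r : ℝ} (hr : 0 < r) (x y : ℝ) :
    |(|y| ^ r * y - |x| ^ r * x)| ≤ (r + 2) * (|x| ^ r + |y| ^ r) * |y - x| := by
  wlog hxy : |x| ≤ |y| generalizing x y
  · have := this y x (le_of_not_ge hxy)
    rwa [abs_sub_comm, add_comm (|x| ^ r), abs_sub_comm y x]
  have h1 := rpow_mul_sub_le hr (abs_nonneg x) hxy
  have h2 : |y| - |x| ≤ |y - x| := abs_sub_abs_le_abs_sub y x
  have hy : 0 ≤ |y| ^ r := Real.rpow_nonneg (abs_nonneg y) r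
  have hx : 0 ≤ |x| ^ r := Real.rpow_nonneg (abs_nonneg x) r
  have hm : |x| ^ r ≤ |y| ^ r := Real.rpow_le_rpow (abs_nonneg x) hxy hr.le
  have h3 : |y| ^ r * y - |x| ^ r * x = |y| ^ r * (y - x) + (|y| ^ r - |x| ^ r) * x := by ring
  calc |(|y| ^ r * y - |x| ^ r * x)|
      ≤ |y| ^ r * |y - x| + (|y| ^ r - |x| ^ r) * |x| := by
        rw [h3]
        refine (abs_add_le _ _).trans ?_
        rw [abs_mul, abs_mul, abs_of_nonneg hy, abs_of_nonneg (sub_nonneg.2 hm)]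
    _ ≤ |y| ^ r * |y - x| + (r + 1) * |y| ^ r * |y - x| := by
        have := h1.trans (mul_le_mul_of_nonneg_left h2 (by positivity))
        linarith
    _ = (r + 2) * (0 + |y| ^ r) * |y - x| := by ring
    _ ≤ _ := by gcongr

/-- Convexity of `t ↦ |t|^q / q`. -/
lemma abs_rpow_div_sub_le {q : ℝ} (hq : 2 < q) (x y : ℝ) :
    |y| ^ q / q - |x| ^ q / q ≤ |y| ^ (q - 2) * y * (y - x) := by
  have hq0 : 0 < q := by linarith
  have hconj : (q / (q - 1)).HolderConjugate q :=
    (Real.HolderConjugate.conjExponent (by linarith : 1 < q)).symm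
  have h := Real.young_inequality (|y| ^ (q - 2) * y) x hconj
  have habs : |(|y| ^ (q - 2) * y)| = |y| ^ (q - 1) := by
    rw [abs_mul, abs_of_nonneg (Real.rpow_nonneg (abs_nonneg y) _)]
    rcases eq_or_ne y 0 with rfl | hy
    · simp [Real.zero_rpow (by linarith : q - 1 ≠ 0)]
    · rw [← Real.rpow_add_one (abs_ne_zero.2 hy)]; ring_nf
  have hsq : |y| ^ (q - 2) * y * y = |y| ^ q := by
    rcases eq_or_ne y 0 with rfl | hy
    · simp [Real.zero_rpow hq0.ne']
    · rw [mul_assoc, ← abs_mul_abs_self y, ← mul_assoc,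
        ← Real.rpow_add_one (abs_ne_zero.2 hy), ← Real.rpow_add_one (abs_ne_zero.2 hy)]
      ring_nf
  rw [habs, ← Real.rpow_mul (abs_nonneg y), mul_div_cancel₀ _ (by linarith : q - 1 ≠ 0)] at h
  have h4 : |y| ^ q / (q / (q - 1)) = |y| ^ q - |y| ^ q / q := by
    field_simp
  rw [h4] at h
  nlinarith

variable {α : Type*} [MeasurableSpace α] {m : Measure α} {q : ℝ}

lemma eLpNorm_ofReal_rpow (hq : 2 < q) (f : α → ℝ) :
    (∫⁻ x, ‖f x‖ₑ ^ q ∂m) = eLpNorm f (ENNReal.ofReal q) m ^ q := by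
  have hq0 : 0 < q := by linarith
  rw [eLpNorm_eq_lintegral_rpow_enorm_toReal (by simpa using hq0) (by simp),
    ENNReal.toReal_ofReal hq0.le, ← ENNReal.rpow_mul, one_div_mul_cancel hq0.ne', ENNReal.rpow_one]

lemma lintegral_rpow_mul_mul_le (hq : 2 < q) {a b c : α → ℝ} (ha : AEStronglyMeasurable a m)
    (hb : AEStronglyMeasurable b m) (hc : AEStronglyMeasurable c m) :
    ∫⁻ x, ‖a x‖ₑ ^ (q - 2) * ‖b x‖ₑ * ‖c x‖ₑ ∂m ≤
      eLpNorm a (ENNReal.ofReal q) m ^ (q - 2) * eLpNorm b (ENNReal.ofReal q) m *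
        eLpNorm c (ENNReal.ofReal q) m := by
  have hq0 : 0 < q := by linarith
  have key := ENNReal.lintegral_prod_norm_pow_le (μ := m) (Finset.univ : Finset (Fin 3))
    (f := ![fun x => ‖a x‖ₑ ^ q, fun x => ‖b x‖ₑ ^ q, fun x => ‖c x‖ₑ ^ q])
    (p := ![(q - 2) / q, 1 / q, 1 / q])
    (by
      intro i _
      fin_cases i
      · exact ha.enorm.pow_const q
      · exact hb.enorm.pow_const q
      · exact hc.enorm.pow_const q)
    (by simp [Fin.sum_univ_three]; field_simp; ring)
    (by
      intro i _
      fin_cases i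
      · exact div_nonneg (by linarith) hq0.le
      · exact one_div_nonneg.2 hq0.le
      · exact one_div_nonneg.2 hq0.le)
  simp only [Fin.prod_univ_three, Matrix.cons_val_zero, Matrix.cons_val_one, Matrix.cons_val,
    eLpNorm_ofReal_rpow hq, ← ENNReal.rpow_mul, mul_div_cancel₀ _ hq0.ne',
    ENNReal.rpow_one] at key
  exact key

lemma abs_rpow_eq (hq : 2 < q) (t : ℝ) : |t| ^ q = |t| ^ (q - 2) * t * t := by
  rcases eq_or_ne t 0 with rfl | hy
  · simp [Real.zero_rpow (by linarith : q ≠ 0)]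
  · rw [mul_assoc, ← abs_mul_abs_self t, ← mul_assoc,
      ← Real.rpow_add_one (abs_ne_zero.2 hy), ← Real.rpow_add_one (abs_ne_zero.2 hy)]
    ring_nf

lemma enorm_rpow_mul_mul (a b c r : ℝ) (hr : 0 ≤ r) :
    ‖|a| ^ r * b * c‖ₑ = ‖a‖ₑ ^ r * ‖b‖ₑ * ‖c‖ₑ := by
  rw [enorm_mul, enorm_mul, Real.enorm_rpow_of_nonneg (abs_nonneg a) hr]
  simp

lemma integrable_rpow_mul_mul (hq : 2 < q) (a b c : Lp ℝ (ENNReal.ofReal q) m) :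
    Integrable (fun x => |a x| ^ (q - 2) * b x * c x) m := by
  have ha := Lp.aestronglyMeasurable a
  have hb := Lp.aestronglyMeasurable b
  have hc := Lp.aestronglyMeasurable c
  refine ⟨(((ha.norm.aemeasurable.pow_const _).aestronglyMeasurable.mul hb).mul hc), ?_⟩
  refine lt_of_le_of_lt ?_ (lt_top_iff_ne_top.2 (ENNReal.mul_ne_top (ENNReal.mul_ne_top
    (ENNReal.rpow_ne_top_of_nonneg (by linarith : 0 ≤ q - 2) (Lp.eLpNorm_ne_top a))
      (Lp.eLpNorm_ne_top b)) (Lp.eLpNorm_ne_top c)))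
  refine le_trans (le_of_eq ?_) (lintegral_rpow_mul_mul_le hq ha hb hc)
  exact lintegral_congr fun x => enorm_rpow_mul_mul _ _ _ _ (by linarith)

lemma integrable_abs_rpow (hq : 2 < q) (u : Lp ℝ (ENNReal.ofReal q) m) :
    Integrable (fun x => |u x| ^ q) m := by
  simp only [abs_rpow_eq hq]
  exact integrable_rpow_mul_mul hq u u u

/-- Hölder's inequality with exponents `q / (q - 2), q, q`. -/
lemma integral_abs_rpow_mul_mul_le (hq : 2 < q) (a b c : Lp ℝ (ENNReal.ofReal q) m) :
    ∫ x, |(|a x| ^ (q - 2) * b x * c x)| ∂m ≤ ‖a‖ ^ (q - 2) * ‖b‖ * ‖c‖ := by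
  have hr : 0 ≤ q - 2 := by linarith
  have h1 : ∫ x, |(|a x| ^ (q - 2) * b x * c x)| ∂m =
      (∫⁻ x, ‖|a x| ^ (q - 2) * b x * c x‖ₑ ∂m).toReal :=
    integral_norm_eq_lintegral_enorm (integrable_rpow_mul_mul hq a b c).1
  rw [h1]
  have h2 : ‖a‖ ^ (q - 2) * ‖b‖ * ‖c‖ = (eLpNorm a (ENNReal.ofReal q) m ^ (q - 2) *
      eLpNorm b (ENNReal.ofReal q) m * eLpNorm c (ENNReal.ofReal q) m).toReal := by
    rw [ENNReal.toReal_mul, ENNReal.toReal_mul, ← ENNReal.toReal_rpow]; rfl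
  rw [h2]
  refine ENNReal.toReal_mono (ENNReal.mul_ne_top (ENNReal.mul_ne_top
    (ENNReal.rpow_ne_top_of_nonneg hr (Lp.eLpNorm_ne_top a))
      (Lp.eLpNorm_ne_top b)) (Lp.eLpNorm_ne_top c)) ?_
  refine le_trans (le_of_eq ?_) (lintegral_rpow_mul_mul_le hq (Lp.aestronglyMeasurable a)
    (Lp.aestronglyMeasurable b) (Lp.aestronglyMeasurable c))
  exact lintegral_congr fun x => enorm_rpow_mul_mul _ _ _ _ hr

lemma abs_integral_rpow_mul_mul_le (hq : 2 < q) (a b c : Lp ℝ (ENNReal.ofReal q) m) :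
    |∫ x, |a x| ^ (q - 2) * b x * c x ∂m| ≤ ‖a‖ ^ (q - 2) * ‖b‖ * ‖c‖ :=
  (abs_integral_le_integral_abs).trans (integral_abs_rpow_mul_mul_le hq a b c)

/-- The functional `u ↦ ∫ |u|^q / q` on `L^q`. -/
def powPrim (u : Lp ℝ (ENNReal.ofReal q) m) : ℝ := ∫ x, |u x| ^ q / q ∂m

variable [Fact (1 ≤ ENNReal.ofReal q)]

/-- The functional `w ↦ ∫ |u|^(q-2) u w` on `L^q`. -/
def powDual (hq : 2 < q) (u : Lp ℝ (ENNReal.ofReal q) m) : Lp ℝ (ENNReal.ofReal q) m →L[ℝ] ℝ :=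
  LinearMap.mkContinuous
    { toFun := fun w => ∫ x, |u x| ^ (q - 2) * u x * w x ∂m
      map_add' := fun w z => by
        rw [← integral_add (integrable_rpow_mul_mul hq u u w) (integrable_rpow_mul_mul hq u u z)]
        refine integral_congr_ae ?_
        filter_upwards [Lp.coeFn_add w z] with x hx
        rw [hx, Pi.add_apply, mul_add]
      map_smul' := fun c w => by
        rw [RingHom.id_apply, smul_eq_mul, ← integral_const_mul]
        refine integral_congr_ae ?_
        filter_upwards [Lp.coeFn_smul c w] with x hx
        rw [hx, Pi.smul_apply, smul_eq_mul]; ring }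
    (‖u‖ ^ (q - 2) * ‖u‖) (fun w => abs_integral_rpow_mul_mul_le hq u u w)

lemma powDual_apply (hq : 2 < q) (u w : Lp ℝ (ENNReal.ofReal q) m) :
    powDual hq u w = ∫ x, |u x| ^ (q - 2) * u x * w x ∂m := rfl

lemma powDual_self (hq : 2 < q) (u : Lp ℝ (ENNReal.ofReal q) m) :
    powDual hq u u = ∫ x, |u x| ^ q ∂m := by
  simp only [abs_rpow_eq hq, powDual_apply]

lemma powPrim_sub_le (hq : 2 < q) (u w : Lp ℝ (ENNReal.ofReal q) m) :
    powPrim w - powPrim u ≤ powDual hq w (w - u) := by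
  rw [powPrim, powPrim, ← integral_sub ((integrable_abs_rpow hq w).div_const q)
    ((integrable_abs_rpow hq u).div_const q), powDual_apply]
  refine integral_mono_ae (((integrable_abs_rpow hq w).div_const q).sub
    ((integrable_abs_rpow hq u).div_const q)) (integrable_rpow_mul_mul hq w w (w - u)) ?_
  filter_upwards [Lp.coeFn_sub w u] with x hx
  rw [hx, Pi.sub_apply]
  exact abs_rpow_div_sub_le hq _ _

lemma norm_powDual_sub_le (hq : 2 < q) (u w : Lp ℝ (ENNReal.ofReal q) m) :
    ‖powDual hq w - powDual hq u‖ ≤ q * (‖u‖ ^ (q - 2) + ‖w‖ ^ (q - 2)) * ‖w - u‖ := by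
  refine ContinuousLinearMap.opNorm_le_bound _ (by positivity) fun z => ?_
  rw [_root_.sub_apply, powDual_apply, powDual_apply,
    ← integral_sub (integrable_rpow_mul_mul hq w w z) (integrable_rpow_mul_mul hq u u z)]
  have i1 := (integrable_rpow_mul_mul hq u (w - u) z).abs
  have i2 := (integrable_rpow_mul_mul hq w (w - u) z).abs
  calc ‖∫ x, (|w x| ^ (q - 2) * w x * z x - |u x| ^ (q - 2) * u x * z x) ∂m‖
      ≤ ∫ x, q * (|(|u x| ^ (q - 2) * (w - u : Lp ℝ _ m) x * z x)| +
          |(|w x| ^ (q - 2) * (w - u : Lp ℝ _ m) x * z x)|) ∂m := by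
        refine norm_integral_le_of_norm_le ((i1.add i2).const_mul q) ?_
        filter_upwards [Lp.coeFn_sub w u] with x hx
        rw [hx, Pi.sub_apply, ← sub_mul, norm_mul, Real.norm_eq_abs, Real.norm_eq_abs]
        have := abs_rpow_mul_sub_le (by linarith : 0 < q - 2) (u x) (w x)
        have h2 := mul_le_mul_of_nonneg_right this (abs_nonneg (z x))
        refine h2.trans (le_of_eq ?_)
        simp only [abs_mul, abs_of_nonneg (Real.rpow_nonneg (abs_nonneg _) _)]
        ring
    _ = q * (∫ x, |(|u x| ^ (q - 2) * (w - u : Lp ℝ _ m) x * z x)| ∂m +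
          ∫ x, |(|w x| ^ (q - 2) * (w - u : Lp ℝ _ m) x * z x)| ∂m) := by
        rw [integral_const_mul, integral_add i1 i2]
    _ ≤ q * (‖u‖ ^ (q - 2) * ‖w - u‖ * ‖z‖ + ‖w‖ ^ (q - 2) * ‖w - u‖ * ‖z‖) := by
        gcongr <;> exact integral_abs_rpow_mul_mul_le hq _ _ _
    _ = _ := by ring

/-- The bound stays a weighted quadratic form instead of passing to norms: at the critical exponent
a norm estimate has no small constant, while the weight can be split into a bounded part and a small
part. -/
lemma powDual_sub_apply_le (hq : 2 < q) (u w : Lp ℝ (ENNReal.ofReal q) m) :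
    (powDual hq w - powDual hq u) (w - u) ≤
      q * (∫ x, |u x| ^ (q - 2) * (w - u : Lp ℝ _ m) x * (w - u : Lp ℝ _ m) x ∂m +
        ∫ x, |w x| ^ (q - 2) * (w - u : Lp ℝ _ m) x * (w - u : Lp ℝ _ m) x ∂m) := by
  have i1 := integrable_rpow_mul_mul hq u (w - u) (w - u)
  have i2 := integrable_rpow_mul_mul hq w (w - u) (w - u)
  rw [_root_.sub_apply, powDual_apply, powDual_apply,
    ← integral_sub (integrable_rpow_mul_mul hq w w _) (integrable_rpow_mul_mul hq u u _),
    ← integral_add i1 i2, ← integral_const_mul]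
  refine integral_mono_ae ((integrable_rpow_mul_mul hq w w _).sub (integrable_rpow_mul_mul hq u u _))
    ((i1.add i2).const_mul q) ?_
  filter_upwards [Lp.coeFn_sub w u] with x hx
  rw [hx, Pi.sub_apply, ← sub_mul]
  have := abs_rpow_mul_sub_le (by linarith : 0 < q - 2) (u x) (w x)
  have h2 := mul_le_mul_of_nonneg_right this (abs_nonneg (w x - u x))
  rw [← abs_mul, mul_assoc _ |w x - u x|, abs_mul_abs_self] at h2
  exact ((le_abs_self _).trans h2).trans (le_of_eq (by ring))

lemma continuous_powDual (hq : 2 < q) :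
    Continuous (powDual hq : Lp ℝ (ENNReal.ofReal q) m → _) := by
  rw [continuous_iff_continuousAt]
  intro u
  rw [ContinuousAt, tendsto_iff_norm_sub_tendsto_zero]
  have h1 : Continuous fun w : Lp ℝ (ENNReal.ofReal q) m =>
      q * (‖u‖ ^ (q - 2) + ‖w‖ ^ (q - 2)) * ‖w - u‖ := by
    have : Continuous fun w : Lp ℝ (ENNReal.ofReal q) m => ‖w‖ ^ (q - 2) :=
      continuous_norm.rpow_const fun _ => Or.inr (by linarith)
    fun_prop
  have h2 := h1.tendsto u
  simp only [sub_self, norm_zero, mul_zero] at h2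
  exact squeeze_zero (fun _ => norm_nonneg _) (fun w => norm_powDual_sub_le hq u w) h2

lemma abs_rpow_le_two_rpow_mul {r : ℝ} (hr : 0 < r) (s t : ℝ) :
    |s + t| ^ r ≤ 2 ^ r * (|s| ^ r + |t| ^ r) := by
  have h1 : |s + t| ≤ 2 * max |s| |t| := by
    refine (abs_add_le s t).trans ?_
    linarith [le_max_left |s| |t|, le_max_right |s| |t|]
  have h0 : 0 ≤ max |s| |t| := (abs_nonneg s).trans (le_max_left _ _)
  calc |s + t| ^ r ≤ (2 * max |s| |t|) ^ r := Real.rpow_le_rpow (abs_nonneg _) h1 hr.le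
    _ = 2 ^ r * (max |s| |t|) ^ r := Real.mul_rpow (by norm_num) h0
    _ ≤ _ := by
      gcongr
      have a1 : 0 ≤ |s| ^ r := Real.rpow_nonneg (abs_nonneg s) r
      have a2 : 0 ≤ |t| ^ r := Real.rpow_nonneg (abs_nonneg t) r
      rcases max_choice |s| |t| with h | h <;> rw [h] <;> linarith

/-- Near a fixed `u₀ ∈ L^q`, the potential `|u|^(q-2)` is form-bounded with arbitrarily small relative
bound by `‖·‖_q²`, up to a multiple of `‖·‖_2²`. -/
lemma eventually_integral_rpow_mul_sq_le (hq : 2 < q) (u₀ : Lp ℝ (ENNReal.ofReal q) m) {ε : ℝ}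
    (hε : 0 < ε) :
    ∃ M : ℝ, ∀ᶠ u in 𝓝 u₀, ∀ (w : Lp ℝ (ENNReal.ofReal q) m) (w₂ : Lp ℝ 2 m), w =ᵐ[m] w₂ →
      ∫ x, |u x| ^ (q - 2) * w x * w x ∂m ≤ ε * ‖w‖ ^ 2 + M * ‖w₂‖ ^ 2 := by
  have hr : 0 < q - 2 := by linarith
  -- The `2 * δ` anticipates a remainder made of two pieces of norm at most `δ` each.
  obtain ⟨δ, hδ, hδε⟩ : ∃ δ : ℝ, 0 < δ ∧ 2 ^ (q - 2) * (2 * δ) ^ (q - 2) ≤ ε := by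
    have hc : Tendsto (fun δ : ℝ => 2 ^ (q - 2) * (2 * δ) ^ (q - 2)) (𝓝[>] 0) (𝓝 0) := by
      have : Continuous fun δ : ℝ => (2 : ℝ) ^ (q - 2) * (2 * δ) ^ (q - 2) :=
        continuous_const.mul ((continuous_const.mul continuous_id).rpow_const fun _ => Or.inr hr.le)
      have h := this.tendsto 0
      simp only [mul_zero, Real.zero_rpow hr.ne'] at h
      exact h.mono_left nhdsWithin_le_nhds
    obtain ⟨δ, h1, h2⟩ := ((hc.eventually (ge_mem_nhds hε)).and self_mem_nhdsWithin).exists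
    exact ⟨δ, h2, h1⟩
  -- The part of `u₀` above a high enough level has small `L^q` norm. The level may come out
  -- negative, hence the maximum with `0`.
  obtain ⟨R₀, hR₀⟩ := (Lp.memLp u₀).eLpNorm_indicator_norm_ge_le (Lp.stronglyMeasurable u₀) hδ
  set R : ℝ := max R₀ 0 with hR
  set S : Set α := {x | R₀ ≤ ‖u₀ x‖₊} with hS
  have hSm : MeasurableSet S :=
    measurableSet_le measurable_const (Lp.stronglyMeasurable u₀).nnnorm.measurable.coe_nnreal_real
  have hmem : MemLp (S.indicator u₀) (ENNReal.ofReal q) m := (Lp.memLp u₀).indicator hSm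
  set z : Lp ℝ (ENNReal.ofReal q) m := hmem.toLp _ with hz
  have hzn : ‖z‖ ≤ δ := by
    rw [hz, Lp.norm_toLp]
    exact ENNReal.toReal_le_of_le_ofReal hδ.le hR₀
  refine ⟨2 ^ (q - 2) * R ^ (q - 2), ?_⟩
  filter_upwards [Metric.ball_mem_nhds u₀ hδ] with u hu w w₂ hw
  rw [Metric.mem_ball, dist_eq_norm] at hu
  -- Now `u` is the truncation of `u₀`, bounded by `R`, plus `ρ`, small in `L^q`: the bounded part
  -- yields the `L²` term, and `ρ` the `ε` term by Hölder.
  set ρ : Lp ℝ (ENNReal.ofReal q) m := (u - u₀) + z with hρ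
  have hρn : ‖ρ‖ ≤ 2 * δ := (norm_add_le _ _).trans (by linarith)
  have hpt : ∀ᵐ x ∂m, |u x| ^ (q - 2) ≤ 2 ^ (q - 2) * (R ^ (q - 2) + |ρ x| ^ (q - 2)) := by
    filter_upwards [Lp.coeFn_add (u - u₀) z, Lp.coeFn_sub u u₀, hmem.coeFn_toLp] with x h1 h2 h3
    rw [hρ, h1, Pi.add_apply, h2, Pi.sub_apply, hz, h3]
    have hd : u x = (u₀ x - S.indicator u₀ x) + (u x - u₀ x + S.indicator u₀ x) := by ring
    have hb : |u₀ x - S.indicator u₀ x| ≤ R := by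
      by_cases hx : x ∈ S
      · simp [hx, hR]
      · have : ¬ R₀ ≤ |u₀ x| := hx
        simp only [hx, not_false_eq_true, indicator_of_notMem, sub_zero]
        exact (le_of_not_ge this).trans (le_max_left _ _)
    calc |u x| ^ (q - 2) = |(u₀ x - S.indicator u₀ x) + (u x - u₀ x + S.indicator u₀ x)| ^ (q - 2) := by
          rw [← hd]
      _ ≤ _ := abs_rpow_le_two_rpow_mul hr _ _
      _ ≤ _ := by gcongr
  have hw2 : Integrable (fun x => w₂ x * w₂ x) m := by
    have := (Lp.memLp w₂).integrable_sq
    simpa [sq] using this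
  have hw2n : ∫ x, w₂ x * w₂ x ∂m = ‖w₂‖ ^ 2 := by
    rw [← real_inner_self_eq_norm_sq, L2.inner_def]
    exact integral_congr_ae (Eventually.of_forall fun x => by simp [sq])
  have i1 := integrable_rpow_mul_mul hq ρ w w
  calc ∫ x, |u x| ^ (q - 2) * w x * w x ∂m
      ≤ ∫ x, (2 ^ (q - 2) * R ^ (q - 2) * (w₂ x * w₂ x) +
          2 ^ (q - 2) * (|ρ x| ^ (q - 2) * w x * w x)) ∂m := by
        refine integral_mono_ae (integrable_rpow_mul_mul hq u w w)
          ((hw2.const_mul _).add (i1.const_mul _)) ?_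
        filter_upwards [hpt, hw] with x h1 h2
        have := mul_le_mul_of_nonneg_right h1 (mul_self_nonneg (w x))
        simp only [← h2]
        linarith
    _ = 2 ^ (q - 2) * R ^ (q - 2) * ‖w₂‖ ^ 2 +
          2 ^ (q - 2) * ∫ x, |ρ x| ^ (q - 2) * w x * w x ∂m := by
        rw [integral_add (hw2.const_mul _) (i1.const_mul _), integral_const_mul,
          integral_const_mul, hw2n]
    _ ≤ 2 ^ (q - 2) * R ^ (q - 2) * ‖w₂‖ ^ 2 + 2 ^ (q - 2) * ((2 * δ) ^ (q - 2) * ‖w‖ * ‖w‖) := by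
        gcongr
        refine (le_abs_self _).trans ((abs_integral_rpow_mul_mul_le hq ρ w w).trans ?_)
        gcongr
    _ ≤ _ := by
        have := mul_le_mul_of_nonneg_right hδε (sq_nonneg ‖w‖)
        linarith

end PowerNonlinearity

/-! ### Translations and short-time averages in `L²` of the line. -/

section Translation

open Filter Topology

variable {H : Type*} [NormedAddCommGroup H]

lemma eLpNorm_two_sq {α : Type*} [MeasurableSpace α] (m : Measure α) (f : α → H) :
    eLpNorm f 2 m ^ 2 = ∫⁻ x, ‖f x‖ₑ ^ 2 ∂m := by
  have := eLpNorm_nnreal_pow_eq_lintegral (f := f) (μ := m) (p := 2) (by norm_num)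
  simpa using this

/-- Translations are continuous in `L²`. -/
lemma tendsto_eLpNorm_shift_sub {f : ℝ → H} (hf : MemLp f 2 volume) :
    Tendsto (fun h : ℝ => eLpNorm (fun τ => f (τ + h) - f τ) 2 volume) (𝓝 0) (𝓝 0) := by
  let g : ℝ → C(ℝ, ℝ) := fun h => ⟨fun τ => τ + h, by fun_prop⟩
  have hg : Continuous g := by
    refine ContinuousMap.continuous_of_continuous_uncurry _ ?_
    simp only [Function.uncurry_def]
    exact continuous_snd.add continuous_fst
  have hgm : ∀ h, MeasurePreserving (g h) volume volume := fun h =>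
    measurePreserving_add_right volume h
  have key := (continuous_const (y := hf.toLp f)).compMeasurePreservingLp hg hgm (by simp)
  have h0 := (key.tendsto 0)
  rw [tendsto_iff_edist_tendsto_0] at h0
  refine h0.congr fun h => ?_
  simp only [Lp.toLp_compMeasurePreserving, Lp.edist_toLp_toLp]
  congr 1
  ext τ
  simp [g]

lemma lintegral_enorm_mul_enorm_le {α : Type*} [MeasurableSpace α] {m : Measure α} {f g : α → H}
    (hf : AEStronglyMeasurable f m) (hg : AEStronglyMeasurable g m) :
    ∫⁻ x, ‖f x‖ₑ * ‖g x‖ₑ ∂m ≤ eLpNorm f 2 m * eLpNorm g 2 m := by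
  have h := ENNReal.lintegral_mul_le_Lp_mul_Lq m Real.HolderConjugate.two_two hf.enorm hg.enorm
  rw [eLpNorm_eq_lintegral_rpow_enorm_toReal (by simp) (by simp),
    eLpNorm_eq_lintegral_rpow_enorm_toReal (by simp) (by simp)]
  simpa using h

variable [NormedSpace ℝ H]

/-- Jensen's inequality: the left side is the square of the mean over `σ ∈ (0, h]` of `f (τ + σ) - f
τ`. -/
lemma enorm_average_sub_sq_le [CompleteSpace H] {f : ℝ → H} (hf : StronglyMeasurable f)
    (hfi : LocallyIntegrable f volume) {h : ℝ} (hh : 0 < h) (τ : ℝ) :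
    ‖h⁻¹ • (∫ σ in τ..τ + h, f σ) - f τ‖ₑ ^ 2 ≤
      ENNReal.ofReal h⁻¹ * ∫⁻ σ in Ioc 0 h, ‖f (τ + σ) - f τ‖ₑ ^ 2 := by
  have hint : IntervalIntegrable (fun σ => f (τ + σ)) volume 0 h := by
    have : IntervalIntegrable f volume (τ + 0) (τ + h) :=
      intervalIntegrable_iff.mpr <|
        (hfi.integrableOn_isCompact isCompact_uIcc).mono_set uIoc_subset_uIcc
    simpa using this.comp_add_left (c := τ) (by simp)
  have e1 : h⁻¹ • (∫ σ in τ..τ + h, f σ) - f τ = h⁻¹ • ∫ σ in (0 : ℝ)..h, (f (τ + σ) - f τ) := by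
    rw [intervalIntegral.integral_sub hint (by simp), intervalIntegral.integral_comp_add_left,
      add_zero, intervalIntegral.integral_const, sub_zero, smul_sub, inv_smul_smul₀ hh.ne']
  have hm : AEStronglyMeasurable (fun σ => f (τ + σ) - f τ) (volume.restrict (Ioc 0 h)) :=
    ((hf.comp_measurable (measurable_const_add τ)).sub stronglyMeasurable_const).aestronglyMeasurable
  have e2 : ‖∫ σ in (0 : ℝ)..h, (f (τ + σ) - f τ)‖ₑ ≤
      eLpNorm (fun σ => f (τ + σ) - f τ) 2 (volume.restrict (Ioc 0 h)) *
        ENNReal.ofReal h ^ (1 / 2 : ℝ) := by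
    rw [intervalIntegral.integral_of_le hh.le]
    refine (enorm_integral_le_lintegral_enorm _).trans ?_
    rw [← eLpNorm_one_eq_lintegral_enorm]
    refine (eLpNorm_le_eLpNorm_mul_rpow_measure_univ (q := 2) (by norm_num) hm).trans
      (le_of_eq ?_)
    simp only [MeasurableSet.univ, Measure.restrict_apply, univ_inter, Real.volume_Ioc, sub_zero]
    norm_num
  rw [e1, enorm_smul, mul_pow, ← eLpNorm_two_sq]
  have e3 : ‖h⁻¹‖ₑ = ENNReal.ofReal h⁻¹ := Real.enorm_of_nonneg (by positivity)
  rw [e3]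
  calc ENNReal.ofReal h⁻¹ ^ 2 * ‖∫ σ in (0 : ℝ)..h, (f (τ + σ) - f τ)‖ₑ ^ 2
      ≤ ENNReal.ofReal h⁻¹ ^ 2 * (eLpNorm (fun σ => f (τ + σ) - f τ) 2
        (volume.restrict (Ioc 0 h)) * ENNReal.ofReal h ^ (1 / 2 : ℝ)) ^ 2 := by gcongr
    _ = ENNReal.ofReal h⁻¹ * (ENNReal.ofReal h⁻¹ * ENNReal.ofReal h) *
        eLpNorm (fun σ => f (τ + σ) - f τ) 2 (volume.restrict (Ioc 0 h)) ^ 2 := by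
      rw [mul_pow (eLpNorm _ _ _), ← ENNReal.rpow_natCast (_ ^ (1 / 2 : ℝ)), ← ENNReal.rpow_mul]
      norm_num
      ring
    _ = _ := by
      rw [← ENNReal.ofReal_mul (by positivity), inv_mul_cancel₀ hh.ne']
      simp

/-- Averages over short intervals converge in `L²`. -/
lemma tendsto_eLpNorm_average_sub [CompleteSpace H] {f : ℝ → H} (hf : StronglyMeasurable f)
    (hf2 : MemLp f 2 volume) :
    Tendsto (fun h : ℝ => eLpNorm (fun τ => h⁻¹ • (∫ σ in τ..τ + h, f σ) - f τ) 2 volume)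
      (𝓝[>] 0) (𝓝 0) := by
  have hfi : LocallyIntegrable f volume := hf2.locallyIntegrable (by norm_num)
  rw [ENNReal.tendsto_nhds_zero]
  intro ε hε
  have h1 := (ENNReal.tendsto_nhds_zero.1 (tendsto_eLpNorm_shift_sub hf2)) ε hε
  obtain ⟨δ, hδ, hball⟩ := Metric.eventually_nhds_iff.1 h1
  have hmem : Ioo (0 : ℝ) δ ∈ 𝓝[>] (0 : ℝ) := Ioo_mem_nhdsGT hδ
  filter_upwards [hmem] with h hh
  have hmeas : Measurable (Function.uncurry fun τ σ : ℝ => ‖f (τ + σ) - f τ‖ₑ ^ 2) := by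
    have a1 : StronglyMeasurable fun p : ℝ × ℝ => f (p.1 + p.2) :=
      hf.comp_measurable (measurable_fst.add measurable_snd)
    have a2 : StronglyMeasurable fun p : ℝ × ℝ => f p.1 := hf.comp_measurable measurable_fst
    exact (a1.sub a2).enorm.pow_const 2
  rw [← ENNReal.pow_le_pow_left_iff (two_ne_zero), eLpNorm_two_sq]
  -- By Tonelli, the squared `L²` error of the average is at most the mean over `σ` of the squared
  -- `L²` errors of the shifts.
  calc ∫⁻ τ, ‖h⁻¹ • (∫ σ in τ..τ + h, f σ) - f τ‖ₑ ^ 2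
      ≤ ∫⁻ τ, ENNReal.ofReal h⁻¹ * ∫⁻ σ in Ioc 0 h, ‖f (τ + σ) - f τ‖ₑ ^ 2 :=
        lintegral_mono fun τ => enorm_average_sub_sq_le hf hfi hh.1 τ
    _ = ENNReal.ofReal h⁻¹ * ∫⁻ σ in Ioc 0 h, ∫⁻ τ, ‖f (τ + σ) - f τ‖ₑ ^ 2 := by
        rw [lintegral_const_mul' _ _ ENNReal.ofReal_ne_top,
          lintegral_lintegral_swap hmeas.aemeasurable]
    _ ≤ ENNReal.ofReal h⁻¹ * ∫⁻ σ in Ioc 0 h, ε ^ 2 := by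
        gcongr 1
        refine setLIntegral_mono measurable_const fun σ hσ => ?_
        rw [← eLpNorm_two_sq]
        gcongr
        refine hball ?_
        rw [Real.dist_eq, sub_zero, abs_of_pos hσ.1]
        exact hσ.2.trans_lt hh.2
    _ = ε ^ 2 := by
        rw [setLIntegral_const, Real.volume_Ioc, sub_zero, mul_comm, mul_assoc,
          ← ENNReal.ofReal_mul hh.1.le, mul_inv_cancel₀ hh.1.ne']
        simp

end Translation

/-! ### Abstract semilinear gradient flows. -/

section GradientFlow

open Filter Topology

variable {X H : Type*} [NormedAddCommGroup X] [NormedSpace ℝ X]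
  [NormedAddCommGroup H] [InnerProductSpace ℝ H]

/-- A coercive symmetric form `a` on `X` perturbed by the derivative `g` of a convex functional `G`,
where `g` is controlled by the form `a` up to terms of lower order, uniformly on small balls. -/
structure SemilinearForm (X H : Type*) [NormedAddCommGroup X] [NormedSpace ℝ X]
    [NormedAddCommGroup H] [InnerProductSpace ℝ H] where
  ι : X →L[ℝ] H
  a : X →L[ℝ] X →L[ℝ] ℝ
  symm : ∀ x y, a x y = a y x
  c : ℝ
  c_pos : 0 < c
  coercive : ∀ x, c * ‖x‖ ^ 2 ≤ a x x
  g : X → X →L[ℝ] ℝ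
  continuous_g : Continuous g
  G : X → ℝ
  convex : ∀ x y, G y - G x ≤ g y (y - x)
  k : X → X → ℝ
  g_sub_le : ∀ x y, (g y - g x) (y - x) ≤ k x (y - x) + k y (y - x)
  k_le : ∀ x₀, ∃ M : ℝ, ∀ᶠ x in 𝓝 x₀, ∀ w, k x w ≤ c / 4 * ‖w‖ ^ 2 + M * ‖ι w‖ ^ 2

lemma intervalIntegrable_clm_comp {Y Z : Type*} [NormedAddCommGroup Y] [NormedSpace ℝ Y]
    [NormedAddCommGroup Z] [NormedSpace ℝ Z] (L : Y →L[ℝ] Z) {φ : ℝ → Y} {a b : ℝ}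
    (hφ : IntervalIntegrable φ volume a b) : IntervalIntegrable (fun τ => L (φ τ)) volume a b :=
  ⟨L.integrable_comp hφ.1, L.integrable_comp hφ.2⟩

namespace SemilinearForm

variable (S : SemilinearForm X H)

/-- The energy `a(x, x) / 2 - G(x)`. -/
def Φ (x : X) : ℝ := 1 / 2 * S.a x x - S.G x

/-- The first variation of the energy. -/
def n (x : X) : X →L[ℝ] ℝ := S.a x - S.g x

lemma continuous_n : Continuous S.n := S.a.continuous.sub S.continuous_g

/-- Convexity used at both points squeezes `G y - G x` between `g x (y - x)` and `g y (y - x)`. -/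
lemma continuous_G : Continuous S.G := by
  rw [continuous_iff_continuousAt]
  intro x
  rw [ContinuousAt, tendsto_iff_norm_sub_tendsto_zero]
  have h1 : Continuous fun y => (‖S.g y‖ + ‖S.g x‖) * ‖y - x‖ := by
    have := S.continuous_g
    fun_prop
  have h2 := h1.tendsto x
  simp only [sub_self, norm_zero, mul_zero] at h2
  refine squeeze_zero (fun _ => norm_nonneg _) (fun y => ?_) h2
  have e1 := S.convex x y
  have e2 := S.convex y x
  have e3 := (le_abs_self _).trans ((S.g y).le_opNorm (y - x))
  have e4 := (le_abs_self _).trans ((S.g x).le_opNorm (x - y))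
  rw [norm_sub_rev x y] at e4
  have p1 : 0 ≤ ‖S.g y‖ * ‖y - x‖ := by positivity
  have p2 : 0 ≤ ‖S.g x‖ * ‖y - x‖ := by positivity
  rw [Real.norm_eq_abs, abs_le, add_mul]
  constructor <;> linarith

lemma continuous_Φ : Continuous S.Φ := by
  have h1 : Continuous fun x => S.a x x := S.a.continuous.clm_apply continuous_id
  exact (continuous_const.mul h1).sub S.continuous_G

/-- Makes the constant in `k_le` uniform along a trajectory on a closed time interval, whose image
is compact in `X`. -/
lemma exists_bound_of_isCompact {s : Set X} (hs : IsCompact s) :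
    ∃ M : ℝ, 0 ≤ M ∧ ∀ x ∈ s, ∀ w, S.k x w ≤ S.c / 4 * ‖w‖ ^ 2 + M * ‖S.ι w‖ ^ 2 := by
  refine hs.induction_on (p := fun s => ∃ M : ℝ, 0 ≤ M ∧ ∀ x ∈ s, ∀ w,
    S.k x w ≤ S.c / 4 * ‖w‖ ^ 2 + M * ‖S.ι w‖ ^ 2) ⟨0, le_rfl, by simp⟩ ?_ ?_ ?_
  · rintro s t hst ⟨M, hM, h⟩
    exact ⟨M, hM, fun x hx => h x (hst hx)⟩
  · rintro s t ⟨M, hM, h⟩ ⟨M', hM', h'⟩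
    refine ⟨max M M', hM.trans (le_max_left _ _), ?_⟩
    rintro x (hx | hx) w
    · refine (h x hx w).trans ?_
      gcongr
      exact le_max_left _ _
    · refine (h' x hx w).trans ?_
      gcongr
      exact le_max_right _ _
  · intro x₀ _
    obtain ⟨M, hM⟩ := S.k_le x₀
    refine ⟨{x | ∀ w, S.k x w ≤ S.c / 4 * ‖w‖ ^ 2 + M * ‖S.ι w‖ ^ 2}, mem_nhdsWithin_of_mem_nhds hM,
      max M 0, le_max_right _ _, fun x hx w => (hx w).trans ?_⟩
    gcongr
    exact le_max_left _ _

/-- The energy increment between two states satisfying the equation. -/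
lemma abs_Φ_sub_add_inner_le {M : ℝ} {x y : X} {p r : H}
    (hx : ∀ w, S.k x w ≤ S.c / 4 * ‖w‖ ^ 2 + M * ‖S.ι w‖ ^ 2)
    (hy : ∀ w, S.k y w ≤ S.c / 4 * ‖w‖ ^ 2 + M * ‖S.ι w‖ ^ 2)
    (hp : ∀ w, inner ℝ p (S.ι w) + S.n x w = 0) (hr : ∀ w, inner ℝ r (S.ι w) + S.n y w = 0) :
    |S.Φ y - S.Φ x + inner ℝ p (S.ι (y - x))| ≤
      2 * M * ‖S.ι (y - x)‖ ^ 2 + 2 * (‖r - p‖ * ‖S.ι (y - x)‖) := by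
  set w := y - x with hw
  -- Subtracting the two equations tested with `w` gives `a w w = (g y - g x) w - ⟪r - p, ι w⟫`. The
  -- two `k` terms cost at most `c/2 ‖w‖² ≤ a w w / 2`, which is absorbed: `a w w ≤ 4M ‖ι w‖² + 2 ‖r
  -- - p‖ ‖ι w‖`.
  have e1 := S.g_sub_le x y
  have e2 := hx w
  have e3 := hy w
  have e4 := S.coercive w
  have e5 := hp w
  have e6 := hr w
  have c1 := S.convex x y
  have c2 := S.convex y x
  have hyx : x - y = -w := by rw [hw]; abel
  rw [hyx, map_neg] at c2
  simp only [n, _root_.sub_apply] at e5 e6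
  rw [← hw] at e1 c1
  rw [_root_.sub_apply] at e1
  have haw : S.a w w = S.a y w - S.a x w := by
    rw [← _root_.sub_apply, ← map_sub]
  -- By symmetry the quadratic part is an exact trapezoidal rule. With convexity of `G`, the
  -- increment differs from `n x w` by at most `a w w / 2 + ‖r - p‖ ‖ι w‖`.
  have hΦ : S.Φ y - S.Φ x = 1 / 2 * (S.a x w + S.a y w) - (S.G y - S.G x) := by
    have : S.a y y - S.a x x = S.a x w + S.a y w := by
      rw [hw, map_sub, map_sub, S.symm x y]; ring
    simp only [Φ]; linarith
  have hin : inner ℝ (r - p) (S.ι w) = inner ℝ r (S.ι w) - inner ℝ p (S.ι w) := inner_sub_left _ _ _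
  have hcs := abs_le.1 (abs_real_inner_le_norm (r - p) (S.ι w))
  rw [hin] at hcs
  rw [hΦ, abs_le]
  constructor <;> linarith [hcs.1, hcs.2]

/-- `V` is a weak solution of the gradient flow on `[0, T)` with time derivative `f`. -/
structure IsFlow (V : ℝ → X) (f : ℝ → H) (T : ℝ) : Prop where
  continuousOn : ContinuousOn V (Ico 0 T)
  stronglyMeasurable : StronglyMeasurable f
  memLp : MemLp f 2 volume
  primitive : ∀ s ∈ Ico 0 T, S.ι (V s) = S.ι (V 0) + ∫ τ in (0 : ℝ)..s, f τ
  equation : ∀ w, ∀ s ∈ Ioo 0 T,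
    ∫ τ in (0 : ℝ)..s, (inner ℝ (f τ) (S.ι w) + S.n (V τ) w) = 0

namespace IsFlow

variable {S} {V : ℝ → X} {f : ℝ → H} {T : ℝ}

lemma intervalIntegrable_f (F : S.IsFlow V f T) (a b : ℝ) : IntervalIntegrable f volume a b :=
  intervalIntegrable_iff.mpr <| ((F.memLp.locallyIntegrable (by norm_num)).integrableOn_isCompact
    isCompact_uIcc).mono_set uIoc_subset_uIcc

lemma intervalIntegrable_of_continuousOn {Z : Type*} [NormedAddCommGroup Z]
    {φ : ℝ → Z} (hφ : ContinuousOn φ (Ico 0 T)) {s t : ℝ} (hs : s ∈ Ico 0 T) (ht : t ∈ Ico 0 T) :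
    IntervalIntegrable φ volume s t :=
  (hφ.mono (ordConnected_Ico.uIcc_subset hs ht)).intervalIntegrable

lemma continuousOn_n (F : S.IsFlow V f T) : ContinuousOn (fun τ => S.n (V τ)) (Ico 0 T) :=
  S.continuous_n.comp_continuousOn F.continuousOn

lemma ι_sub (F : S.IsFlow V f T) {s t : ℝ} (hs : s ∈ Ico 0 T) (ht : t ∈ Ico 0 T) :
    S.ι (V t) - S.ι (V s) = ∫ τ in s..t, f τ := by
  rw [F.primitive s hs, F.primitive t ht, add_sub_add_left_eq_sub,
    intervalIntegral.integral_interval_sub_left (F.intervalIntegrable_f _ _)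
      (F.intervalIntegrable_f _ _)]

/-- The equation in the dual of `X`. -/
lemma ae_equation [CompleteSpace H] (F : S.IsFlow V f T) :
    ∀ᵐ τ, τ ∈ Ioo 0 T → ∀ w, inner ℝ (f τ) (S.ι w) + S.n (V τ) w = 0 := by
  -- Both terms are read as functions of time with values in the dual of `X`, so that one
  -- exceptional null set serves every `w`.
  set L : H →L[ℝ] X →L[ℝ] ℝ := (innerSL ℝ).flip.flip.bilinearComp (.id ℝ H) S.ι with hL
  have hLapp : ∀ p w, L p w = inner ℝ p (S.ι w) := fun p w => rfl
  set φ : ℝ → X →L[ℝ] ℝ := fun τ => L (f τ) + S.n (V τ) with hφ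
  have hint : ∀ s ∈ Ico 0 T, IntervalIntegrable φ volume 0 s := fun s hs =>
    ((intervalIntegrable_clm_comp L (F.intervalIntegrable_f 0 s)).add
      (intervalIntegrable_of_continuousOn F.continuousOn_n ⟨le_rfl, hs.1.trans_lt hs.2⟩ hs))
  have hzero : ∀ s ∈ Ioo 0 T, ∫ τ in (0 : ℝ)..s, φ τ = 0 := by
    intro s hs
    ext w
    rw [ContinuousLinearMap.intervalIntegral_apply (hint s ⟨hs.1.le, hs.2⟩)]
    exact F.equation w s hs
  -- Lebesgue differentiation of a vanishing primitive. Continuity on `[0, T)` gives integrability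
  -- only up to `b < T`, hence the exhaustion by a sequence below.
  have hmain : ∀ b ∈ Ioo 0 T, ∀ᵐ τ, τ ∈ Ioo 0 b → φ τ = 0 := by
    intro b hb
    filter_upwards [(hint b ⟨hb.1.le, hb.2⟩).ae_hasDerivAt_integral] with τ hτ hτb
    have h1 := hτ (by rw [uIcc_of_le hb.1.le]; exact ⟨hτb.1.le, hτb.2.le⟩) 0 left_mem_uIcc
    refine h1.unique ((hasDerivAt_const τ (0 : X →L[ℝ] ℝ)).congr_of_eventuallyEq ?_)
    filter_upwards [Ioo_mem_nhds hτb.1 hτb.2] with s hs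
    exact hzero s ⟨hs.1, hs.2.trans hb.2⟩
  obtain ⟨u, -, hu, hlim⟩ := exists_seq_strictMono_tendsto T
  have hall : ∀ᵐ τ, ∀ k, u k ∈ Ioo 0 T → τ ∈ Ioo 0 (u k) → φ τ = 0 := by
    rw [ae_all_iff]
    intro k
    by_cases hk : u k ∈ Ioo 0 T
    · filter_upwards [hmain _ hk] with τ h _ using h
    · exact Eventually.of_forall fun τ h => absurd h hk
  filter_upwards [hall] with τ hτ hτT w
  obtain ⟨k, hk⟩ := (hlim.eventually (lt_mem_nhds hτT.2)).exists
  have := hτ k ⟨hτT.1.trans hk, hu k⟩ ⟨hτT.1, hk⟩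
  have h2 := DFunLike.congr_fun this w
  exact h2

/-- The derivative of `‖ι V‖²`. -/
lemma hasDerivAt_norm_sq [CompleteSpace H] (F : S.IsFlow V f T) {τ : ℝ} (hτ : τ ∈ Ioo 0 T) :
    HasDerivAt (fun s => ‖S.ι (V s)‖ ^ 2) (-2 * S.n (V τ) (V τ)) τ := by
  have hnhds : Ico 0 T ∈ 𝓝 τ := Ico_mem_nhds hτ.1 hτ.2
  have hτ' : τ ∈ Ico 0 T := ⟨hτ.1.le, hτ.2⟩
  have hinner : ∀ w, ∀ s ∈ Ico 0 T,
      inner ℝ (S.ι (V s) - S.ι (V τ)) (S.ι w) = - ∫ σ in τ..s, S.n (V σ) w := by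
    intro w s hs
    have h1 : inner ℝ (∫ σ in τ..s, f σ) (S.ι w) = ∫ σ in τ..s, inner ℝ (f σ) (S.ι w) := by
      have := (innerSL ℝ (S.ι w)).intervalIntegral_comp_comm (F.intervalIntegrable_f τ s)
      simp only [innerSL_apply_apply] at this
      rw [real_inner_comm, ← this]
      simp only [real_inner_comm]
    rw [F.ι_sub hτ' hs, h1, ← intervalIntegral.integral_neg]
    refine intervalIntegral.integral_congr_ae ?_
    filter_upwards [F.ae_equation, Measure.ae_ne volume (0 : ℝ)] with σ hσ h0 hmem
    have hσT := ordConnected_Ico.uIcc_subset hτ' hs (uIoc_subset_uIcc hmem)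
    linarith [hσ ⟨lt_of_le_of_ne hσT.1 h0.symm, hσT.2⟩ w]
  have hd1 : HasDerivAt (fun s => inner ℝ (S.ι (V s) - S.ι (V τ)) (S.ι (V τ)))
      (-(S.n (V τ) (V τ))) τ := by
    have hc : ContinuousOn (fun σ => S.n (V σ) (V τ)) (Ico 0 T) :=
      F.continuousOn_n.clm_apply continuousOn_const
    have h1 : HasDerivAt (fun s => ∫ σ in τ..s, S.n (V σ) (V τ)) (S.n (V τ) (V τ)) τ :=
      intervalIntegral.integral_hasDerivAt_right (by simp)
        (hc.mono Ioo_subset_Ico_self |>.stronglyMeasurableAtFilter isOpen_Ioo τ hτ)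
        (hc.continuousAt hnhds)
    refine h1.neg.congr_of_eventuallyEq ?_
    filter_upwards [hnhds] with s hs using hinner _ s hs
  -- Testing the integrated equation with `V s - V τ` bounds this square by a constant times `‖V s -
  -- V τ‖ |s - τ|`, which is `o(s - τ)` by continuity in `X`. Hence the derivative exists at every
  -- `τ`, although `f` is only defined almost everywhere.
  have hd2 : HasDerivAt (fun s => ‖S.ι (V s) - S.ι (V τ)‖ ^ 2) 0 τ := by
    rw [hasDerivAt_iff_isLittleO]
    simp only [sub_self, norm_zero, smul_zero, sub_zero, ne_eq, OfNat.ofNat_ne_zero,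
      not_false_eq_true, zero_pow]
    obtain ⟨r, hr, hball⟩ : ∃ r > 0, ∀ s, dist s τ < r → s ∈ Ico 0 T ∧
        ‖S.n (V s)‖ ≤ ‖S.n (V τ)‖ + 1 := by
      refine Metric.eventually_nhds_iff.1 (Filter.Eventually.and hnhds ?_)
      have := (F.continuousOn_n.continuousAt hnhds).norm
      filter_upwards [this.eventually (gt_mem_nhds (lt_add_one ‖S.n (V τ)‖))] with s hs using hs.le
    have hO : (fun s => ‖S.ι (V s) - S.ι (V τ)‖ ^ 2) =O[𝓝 τ]
        fun s => ‖V s - V τ‖ * (s - τ) := by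
      refine Asymptotics.IsBigO.of_bound (‖S.n (V τ)‖ + 1) ?_
      filter_upwards [Metric.ball_mem_nhds τ hr] with s hs
      have h1 := hinner (V s - V τ) s (hball s hs).1
      rw [map_sub, real_inner_self_eq_norm_sq] at h1
      rw [h1, norm_neg, norm_mul, norm_norm, ← mul_assoc]
      refine intervalIntegral.norm_integral_le_of_norm_le_const fun σ hσ => ?_
      refine ((S.n (V σ)).le_opNorm _).trans ?_
      gcongr
      refine (hball σ ?_).2
      have hσ' := uIoc_subset_uIcc hσ
      exact (convex_ball τ r).ordConnected.uIcc_subset (Metric.mem_ball_self hr) hs hσ'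
    refine hO.trans_isLittleO ?_
    have hV : (fun s => ‖V s - V τ‖) =o[𝓝 τ] fun _ => (1 : ℝ) := by
      rw [Asymptotics.isLittleO_one_iff]
      exact tendsto_iff_norm_sub_tendsto_zero.1 (F.continuousOn.continuousAt hnhds)
    simpa using hV.mul_isBigO (Asymptotics.isBigO_refl (fun s => s - τ) (𝓝 τ))
  have hd3 := ((hd1.const_mul 2).add hd2).const_add (‖S.ι (V τ)‖ ^ 2)
  refine (hd3.congr_of_eventuallyEq (Eventually.of_forall fun s => ?_)).congr_deriv (by ring)
  have : S.ι (V s) = S.ι (V τ) + (S.ι (V s) - S.ι (V τ)) := by abel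
  nth_rewrite 1 [this]
  rw [norm_add_sq_real, real_inner_comm]
  simp only [Pi.add_apply]
  ring

end IsFlow

end SemilinearForm

end GradientFlow

/-! ### The energy identity for solutions with square-integrable time derivative. -/

section EnergyIdentity

open Filter Topology

variable {X H : Type*} [NormedAddCommGroup X] [NormedSpace ℝ X]
  [NormedAddCommGroup H] [InnerProductSpace ℝ H]

/-- One-sided, so that the initial time is included. -/
lemma tendsto_average_right {φ : ℝ → ℝ} {T t : ℝ} (hφ : ContinuousOn φ (Ico 0 T))
    (ht : t ∈ Ico 0 T) :
    Tendsto (fun h : ℝ => h⁻¹ * ∫ τ in t..t + h, φ τ) (𝓝[>] 0) (𝓝 (φ t)) := by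
  have hm : StronglyMeasurableAtFilter φ (𝓝[>] t) := by
    refine ⟨Ioo t T, Ioo_mem_nhdsGT ht.2, ?_⟩
    exact (hφ.mono fun x hx => ⟨ht.1.trans hx.1.le, hx.2⟩).aestronglyMeasurable measurableSet_Ioo
  have hc : ContinuousWithinAt φ (Ioi t) t := by
    refine (hφ t ht).mono_of_mem_nhdsWithin ?_
    exact mem_of_superset (Ioo_mem_nhdsGT ht.2) fun x hx => ⟨ht.1.trans hx.1.le, hx.2⟩
  have h1 : HasDerivWithinAt (fun u => ∫ τ in t..u, φ τ) (φ t) (Ici t) t :=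
    intervalIntegral.integral_hasDerivWithinAt_right (by simp) hm hc
  rw [hasDerivWithinAt_iff_tendsto_slope, Ici_sdiff_left] at h1
  have h2 : Tendsto (fun h : ℝ => t + h) (𝓝[>] 0) (𝓝[>] t) := by
    refine tendsto_nhdsWithin_iff.2 ⟨?_, ?_⟩
    · have : Continuous fun h : ℝ => t + h := by fun_prop
      simpa using (this.tendsto 0).mono_left nhdsWithin_le_nhds
    · filter_upwards [self_mem_nhdsWithin] with h hh
      simpa using hh
  refine (h1.comp h2).congr fun h => ?_
  simp [slope]

variable {S : SemilinearForm X H} {V : ℝ → X} {f : ℝ → H} {T : ℝ}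

namespace SemilinearForm.IsFlow

/-- The increment estimate divided by `h`, with `ι (V (τ + h) - V τ) = h (f τ + Q)`. Every product
on the right contains `h`, the averaging error `Q` or a translation error of `f`. -/
lemma abs_slope_Φ_add_le {M h τ : ℝ} (F : S.IsFlow V f T) (hM : 0 ≤ M) (hh : 0 < h)
    (hτ : τ ∈ Ico 0 T) (hτh : τ + h ∈ Ico 0 T)
    (hx : ∀ w, S.k (V τ) w ≤ S.c / 4 * ‖w‖ ^ 2 + M * ‖S.ι w‖ ^ 2)
    (hy : ∀ w, S.k (V (τ + h)) w ≤ S.c / 4 * ‖w‖ ^ 2 + M * ‖S.ι w‖ ^ 2)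
    (hp : ∀ w, inner ℝ (f τ) (S.ι w) + S.n (V τ) w = 0)
    (hr : ∀ w, inner ℝ (f (τ + h)) (S.ι w) + S.n (V (τ + h)) w = 0) {Q : H}
    (hQ : Q = h⁻¹ • (∫ σ in τ..τ + h, f σ) - f τ) :
    |h⁻¹ * (S.Φ (V (τ + h)) - S.Φ (V τ)) + ‖f τ‖ ^ 2| ≤
      ‖f τ‖ * ‖Q‖ + 4 * M * h * (‖f τ‖ * ‖f τ‖ + ‖Q‖ * ‖Q‖) +
        2 * (‖f (τ + h) - f τ‖ * ‖f τ‖ + ‖f (τ + h) - f τ‖ * ‖Q‖) := by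
  have key := S.abs_Φ_sub_add_inner_le hx hy hp hr
  have hw : S.ι (V (τ + h) - V τ) = h • (f τ + Q) := by
    rw [map_sub, F.ι_sub hτ hτh, hQ, add_sub_cancel, smul_inv_smul₀ hh.ne']
  rw [hw, norm_smul, Real.norm_of_nonneg hh.le, inner_smul_right, inner_add_right,
    real_inner_self_eq_norm_sq] at key
  have hn := norm_add_le (f τ) Q
  set A := ‖f τ‖
  set B := ‖Q‖
  set D := ‖f (τ + h) - f τ‖
  set N := ‖f τ + Q‖
  have hA : 0 ≤ A := norm_nonneg _
  have hB : 0 ≤ B := norm_nonneg _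
  have hD : 0 ≤ D := norm_nonneg _
  have hN : 0 ≤ N := norm_nonneg _
  have hN2 : N ^ 2 ≤ 2 * (A * A + B * B) := by nlinarith [sq_nonneg (A - B)]
  have hin : |inner ℝ (f τ) Q| ≤ A * B := abs_real_inner_le_norm _ _
  have e1 : h⁻¹ * (S.Φ (V (τ + h)) - S.Φ (V τ)) + A ^ 2 =
      h⁻¹ * (S.Φ (V (τ + h)) - S.Φ (V τ) + h * (A ^ 2 + inner ℝ (f τ) Q)) - inner ℝ (f τ) Q := by
    field_simp; ring
  rw [e1]
  calc _ ≤ |h⁻¹ * (S.Φ (V (τ + h)) - S.Φ (V τ) + h * (A ^ 2 + inner ℝ (f τ) Q))| +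
        |inner ℝ (f τ) Q| := abs_sub _ _
    _ ≤ h⁻¹ * (2 * M * (h * N) ^ 2 + 2 * (D * (h * N))) + A * B := by
        rw [abs_mul, abs_of_pos (inv_pos.2 hh)]
        gcongr
    _ = 2 * M * h * N ^ 2 + 2 * (D * N) + A * B := by field_simp
    _ ≤ 2 * M * h * (2 * (A * A + B * B)) + 2 * (D * (A + B)) + A * B := by gcongr
    _ = _ := by ring

/-- The Cauchy–Schwarz majorant of the integrated right side of `abs_slope_Φ_add_le`. -/
lemma tendsto_remainder [CompleteSpace H] {f : ℝ → H} (hf : StronglyMeasurable f) (hf2 : MemLp f 2 volume) (M : ℝ) :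
    Tendsto (fun h : ℝ =>
      eLpNorm f 2 volume * eLpNorm (fun τ => h⁻¹ • (∫ σ in τ..τ + h, f σ) - f τ) 2 volume +
      ENNReal.ofReal (4 * M * h) * (eLpNorm f 2 volume * eLpNorm f 2 volume +
        eLpNorm (fun τ => h⁻¹ • (∫ σ in τ..τ + h, f σ) - f τ) 2 volume *
        eLpNorm (fun τ => h⁻¹ • (∫ σ in τ..τ + h, f σ) - f τ) 2 volume) +
      2 * (eLpNorm (fun τ => f (τ + h) - f τ) 2 volume * eLpNorm f 2 volume +
        eLpNorm (fun τ => f (τ + h) - f τ) 2 volume *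
          eLpNorm (fun τ => h⁻¹ • (∫ σ in τ..τ + h, f σ) - f τ) 2 volume)) (𝓝[>] 0) (𝓝 0) := by
  have hq := tendsto_eLpNorm_average_sub hf hf2
  have hd := (tendsto_eLpNorm_shift_sub hf2).mono_left (nhdsWithin_le_nhds (s := Ioi 0))
  have hf' : eLpNorm f 2 volume ≠ ⊤ := hf2.2.ne
  have hc : Tendsto (fun h : ℝ => ENNReal.ofReal (4 * M * h)) (𝓝[>] 0) (𝓝 0) := by
    have : Continuous fun h : ℝ => ENNReal.ofReal (4 * M * h) :=
      ENNReal.continuous_ofReal.comp (by fun_prop)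
    simpa using (this.tendsto 0).mono_left nhdsWithin_le_nhds
  have t1 := ENNReal.Tendsto.const_mul hq (Or.inr hf')
  have t2 := ENNReal.Tendsto.mul hq (Or.inr ENNReal.zero_ne_top) hq (Or.inr ENNReal.zero_ne_top)
  have t3 := ENNReal.Tendsto.mul hc (Or.inr (by simp [ENNReal.mul_eq_top, hf']))
    (t2.const_add (eLpNorm f 2 volume * eLpNorm f 2 volume)) (Or.inr ENNReal.zero_ne_top)
  have t4 := ENNReal.Tendsto.mul_const hd (Or.inr hf')
  have t5 := ENNReal.Tendsto.mul hd (Or.inr ENNReal.zero_ne_top) hq (Or.inr ENNReal.zero_ne_top)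
  have t6 := ENNReal.Tendsto.const_mul (a := 2) (t4.add t5) (Or.inr (by simp))
  simpa using (t1.add t3).add t6

/-- The energy identity. -/
theorem energy_identity [CompleteSpace H] (F : S.IsFlow V f T) {s t : ℝ} (hs : 0 ≤ s) (hst : s ≤ t) (htT : t < T) :
    S.Φ (V t) - S.Φ (V s) = - ∫ τ in s..t, ‖f τ‖ ^ 2 := by
  have hφ : ContinuousOn (fun τ => S.Φ (V τ)) (Ico 0 T) :=
    S.continuous_Φ.comp_continuousOn F.continuousOn
  have hsm : s ∈ Ico 0 T := ⟨hs, hst.trans_lt htT⟩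
  have htm : t ∈ Ico 0 T := ⟨hs.trans hst, htT⟩
  have hf2i : IntervalIntegrable (fun τ => ‖f τ‖ ^ 2) volume s t := by
    have := F.memLp.integrable_norm_pow (by norm_num)
    exact this.intervalIntegrable
  -- Room for the shift by `h`, while the states in play stay in the compact image of `[0, T₁]`.
  obtain ⟨T₁, hT₁, hT₁T⟩ := exists_between htT
  obtain ⟨M, hM, hbound⟩ := S.exists_bound_of_isCompact
    (isCompact_Icc.image_of_continuousOn (F.continuousOn.mono (Icc_subset_Ico_right hT₁T)))
  have hsmall : Ioo 0 (T₁ - t) ∈ 𝓝[>] (0 : ℝ) := Ioo_mem_nhdsGT (by linarith)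
  have hIco : ∀ τ ∈ Icc s t, ∀ h ∈ Ioo 0 (T₁ - t), τ + h ∈ Ico 0 T := fun τ hτ h hh =>
    ⟨by linarith [hτ.1, hh.1], by linarith [hτ.2, hh.2]⟩
  set J : ℝ → ℝ := fun h =>
    ∫ τ in s..t, (h⁻¹ * (S.Φ (V (τ + h)) - S.Φ (V τ)) + ‖f τ‖ ^ 2) with hJ
  -- The integrated difference quotient telescopes to the averages of `Φ ∘ V` over `[t, t + h]`
  -- minus those over `[s, s + h]`.
  have hlim : Tendsto J (𝓝[>] 0) (𝓝 (S.Φ (V t) - S.Φ (V s) + ∫ τ in s..t, ‖f τ‖ ^ 2)) := by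
    refine (((tendsto_average_right hφ htm).sub (tendsto_average_right hφ hsm)).add_const
      (∫ τ in s..t, ‖f τ‖ ^ 2)).congr' ?_
    filter_upwards [hsmall] with h hh
    have hsh := hIco s ⟨le_rfl, hst⟩ h hh
    have hth := hIco t ⟨hst, le_rfl⟩ h hh
    have i1 : IntervalIntegrable (fun τ => S.Φ (V (τ + h))) volume s t := by
      have := (intervalIntegrable_of_continuousOn hφ hsh hth).comp_add_right (c := h) (by simp)
      simpa using this
    have i2 := intervalIntegrable_of_continuousOn hφ hsm htm
    have e1 : ∫ τ in s..t, S.Φ (V (τ + h)) = ∫ τ in s + h..t + h, S.Φ (V τ) :=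
      intervalIntegral.integral_comp_add_right (fun τ => S.Φ (V τ)) h
    have e2 := intervalIntegral.integral_add_adjacent_intervals
      (intervalIntegrable_of_continuousOn hφ hsm hsh)
      (intervalIntegrable_of_continuousOn hφ hsh hth)
    have e3 := intervalIntegral.integral_add_adjacent_intervals
      (intervalIntegrable_of_continuousOn hφ hsm htm)
      (intervalIntegrable_of_continuousOn hφ htm hth)
    rw [hJ]
    simp only
    rw [intervalIntegral.integral_add ((i1.sub i2).const_mul _) hf2i,
      intervalIntegral.integral_const_mul, intervalIntegral.integral_sub i1 i2, e1]
    rw [← mul_sub]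
    congr 2
    linarith
  have hzero : Tendsto J (𝓝[>] 0) (𝓝 0) := by
    rw [tendsto_zero_iff_enorm_tendsto_zero]
    refine tendsto_of_tendsto_of_tendsto_of_le_of_le' tendsto_const_nhds
      (tendsto_remainder F.stronglyMeasurable F.memLp M) (Eventually.of_forall fun _ => zero_le) ?_
    filter_upwards [hsmall] with h hh
    set Q : ℝ → H := fun τ => h⁻¹ • (∫ σ in τ..τ + h, f σ) - f τ with hQ
    have mf : AEStronglyMeasurable f volume := F.stronglyMeasurable.aestronglyMeasurable
    have mD : AEStronglyMeasurable (fun τ => f (τ + h) - f τ) volume :=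
      ((F.stronglyMeasurable.comp_measurable (measurable_add_const h)).sub
        F.stronglyMeasurable).aestronglyMeasurable
    have mQ : AEStronglyMeasurable Q volume := by
      have hP : Continuous fun u => ∫ σ in (0 : ℝ)..u, f σ :=
        intervalIntegral.continuous_primitive F.intervalIntegrable_f 0
      have hP2 : Continuous fun τ => ∫ σ in τ..τ + h, f σ := by
        have : Continuous fun τ => (∫ σ in (0 : ℝ)..τ + h, f σ) - ∫ σ in (0 : ℝ)..τ, f σ :=
          (hP.comp (continuous_add_const h)).sub hP
        refine this.congr fun τ => ?_
        rw [intervalIntegral.integral_interval_sub_left (F.intervalIntegrable_f _ _)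
          (F.intervalIntegrable_f _ _)]
      exact (hP2.const_smul h⁻¹).aestronglyMeasurable.sub mf
    have hpt : ∀ᵐ τ, τ ∈ Ioc s t → ‖h⁻¹ * (S.Φ (V (τ + h)) - S.Φ (V τ)) + ‖f τ‖ ^ 2‖ₑ ≤
        ‖f τ‖ₑ * ‖Q τ‖ₑ + ENNReal.ofReal (4 * M * h) * (‖f τ‖ₑ * ‖f τ‖ₑ + ‖Q τ‖ₑ * ‖Q τ‖ₑ) +
        2 * (‖f (τ + h) - f τ‖ₑ * ‖f τ‖ₑ + ‖f (τ + h) - f τ‖ₑ * ‖Q τ‖ₑ) := by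
      have hshift := (measurePreserving_add_right volume h).quasiMeasurePreserving.ae F.ae_equation
      filter_upwards [F.ae_equation, hshift] with τ h1 h2 hτ
      have hτ0 : 0 < τ := hs.trans_lt hτ.1
      have hτT := hIco τ ⟨hτ.1.le, hτ.2⟩ h hh
      have hb := F.abs_slope_Φ_add_le hM hh.1 ⟨hτ0.le, hτ.2.trans_lt htT⟩ hτT
        (hbound _ ⟨τ, ⟨hτ0.le, hτ.2.trans hT₁.le⟩, rfl⟩)
        (hbound _ ⟨τ + h, ⟨hτT.1, by linarith [hτ.2, hh.2]⟩, rfl⟩)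
        (h1 ⟨hτ0, hτ.2.trans_lt htT⟩) (h2 ⟨by linarith [hh.1], hτT.2⟩) (Q := Q τ) rfl
      have h4 : 0 ≤ 4 * M * h := by have := hh.1; positivity
      rw [← ofReal_norm, Real.norm_eq_abs]
      refine (ENNReal.ofReal_le_ofReal hb).trans (le_of_eq ?_)
      rw [ENNReal.ofReal_add (by positivity) (by positivity),
        ENNReal.ofReal_add (by positivity) (by positivity),
        ENNReal.ofReal_mul (norm_nonneg _), ENNReal.ofReal_mul h4,
        ENNReal.ofReal_add (by positivity) (by positivity), ENNReal.ofReal_mul (norm_nonneg _),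
        ENNReal.ofReal_mul (norm_nonneg _), ENNReal.ofReal_mul (by norm_num : (0 : ℝ) ≤ 2),
        ENNReal.ofReal_add (by positivity) (by positivity), ENNReal.ofReal_mul (norm_nonneg _),
        ENNReal.ofReal_mul (norm_nonneg _)]
      simp only [ofReal_norm]
      norm_num
    calc ‖J h‖ₑ ≤ ∫⁻ τ in Ioc s t, ‖h⁻¹ * (S.Φ (V (τ + h)) - S.Φ (V τ)) + ‖f τ‖ ^ 2‖ₑ := by
          rw [hJ]
          simp only
          rw [intervalIntegral.integral_of_le hst]
          exact enorm_integral_le_lintegral_enorm _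
      _ ≤ ∫⁻ τ in Ioc s t, (‖f τ‖ₑ * ‖Q τ‖ₑ +
            ENNReal.ofReal (4 * M * h) * (‖f τ‖ₑ * ‖f τ‖ₑ + ‖Q τ‖ₑ * ‖Q τ‖ₑ) +
            2 * (‖f (τ + h) - f τ‖ₑ * ‖f τ‖ₑ + ‖f (τ + h) - f τ‖ₑ * ‖Q τ‖ₑ)) :=
          setLIntegral_mono_ae' measurableSet_Ioc hpt
      _ ≤ ∫⁻ τ, (‖f τ‖ₑ * ‖Q τ‖ₑ +
            ENNReal.ofReal (4 * M * h) * (‖f τ‖ₑ * ‖f τ‖ₑ + ‖Q τ‖ₑ * ‖Q τ‖ₑ) +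
            2 * (‖f (τ + h) - f τ‖ₑ * ‖f τ‖ₑ + ‖f (τ + h) - f τ‖ₑ * ‖Q τ‖ₑ)) :=
          setLIntegral_le_lintegral _ _
      _ = (∫⁻ τ, ‖f τ‖ₑ * ‖Q τ‖ₑ) +
            ENNReal.ofReal (4 * M * h) *
              ((∫⁻ τ, ‖f τ‖ₑ * ‖f τ‖ₑ) + ∫⁻ τ, ‖Q τ‖ₑ * ‖Q τ‖ₑ) +
            2 * ((∫⁻ τ, ‖f (τ + h) - f τ‖ₑ * ‖f τ‖ₑ) +
              ∫⁻ τ, ‖f (τ + h) - f τ‖ₑ * ‖Q τ‖ₑ) := by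
          have m1 : AEMeasurable (fun τ => ‖f τ‖ₑ * ‖Q τ‖ₑ) volume := mf.enorm.mul mQ.enorm
          have m2 : AEMeasurable (fun τ => ‖f τ‖ₑ * ‖f τ‖ₑ) volume := mf.enorm.mul mf.enorm
          have m3 : AEMeasurable (fun τ => ‖Q τ‖ₑ * ‖Q τ‖ₑ) volume := mQ.enorm.mul mQ.enorm
          have m4 : AEMeasurable (fun τ => ‖f (τ + h) - f τ‖ₑ * ‖f τ‖ₑ) volume :=
            mD.enorm.mul mf.enorm
          have m5 : AEMeasurable (fun τ => ENNReal.ofReal (4 * M * h) *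
              (‖f τ‖ₑ * ‖f τ‖ₑ + ‖Q τ‖ₑ * ‖Q τ‖ₑ)) volume := (m2.fun_add m3).const_mul _
          rw [lintegral_add_left' (m1.fun_add m5), lintegral_add_left' m1,
            lintegral_const_mul' _ _ ENNReal.ofReal_ne_top,
            lintegral_const_mul' _ _ (by simp), lintegral_add_left' m2, lintegral_add_left' m4]
      _ ≤ _ := by
          gcongr <;> exact lintegral_enorm_mul_enorm_le (by assumption) (by assumption)
  linarith [tendsto_nhds_unique hlim hzero]

end SemilinearForm.IsFlow

end EnergyIdentity

/-! ### Scalar potential-well and concavity argument. -/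

section BlowUp

open Filter Topology

/-- The scalar inequalities along a trajectory which starts outside the potential well: `e` is the
energy, `m` the squared norm, `D` the Nehari functional, `d` the depth of the well. -/
structure OutsideWell (e m D : ℝ → ℝ) (d q T : ℝ) : Prop where
  two_lt : 2 < q
  cont_m : ContinuousOn m (Ico 0 T)
  cont_e : ContinuousOn e (Ico 0 T)
  cont_D : ContinuousOn D (Ico 0 T)
  deriv_m : ∀ τ ∈ Ioo 0 T, HasDerivAt m (-2 * D τ) τ
  m_nonneg : ∀ τ, 0 ≤ m τ
  m_pos : ∀ τ ∈ Ico 0 T, D τ < 0 → 0 < m τ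
  dissipation : ∀ s t, 0 ≤ s → s ≤ t → t < T → e t - e s ≤ - ∫ τ in s..t, D τ ^ 2 / m τ
  le_of_neg : ∀ τ ∈ Ico 0 T, D τ < 0 → D τ ≤ q * (e τ - d)

namespace OutsideWell

variable {e m D : ℝ → ℝ} {d q T : ℝ}

lemma antitone (O : OutsideWell e m D d q T) {s t : ℝ} (hs : 0 ≤ s) (hst : s ≤ t) (ht : t < T) :
    e t ≤ e s := by
  have h1 := O.dissipation s t hs hst ht
  have h2 : 0 ≤ ∫ τ in s..t, D τ ^ 2 / m τ :=
    intervalIntegral.integral_nonneg hst fun τ _ => div_nonneg (sq_nonneg _) (O.m_nonneg τ)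
  linarith

/-- Turns critical energy into subcritical energy: while `D < 0` the dissipation density is
positive. -/
lemma lt_initial (O : OutsideWell e m D d q T) {s : ℝ} (hs : 0 < s) (hsT : s < T)
    (hneg : ∀ τ ∈ Icc 0 s, D τ < 0) : e s < e 0 := by
  have h1 := O.dissipation 0 s le_rfl hs.le hsT
  have hsub : Icc 0 s ⊆ Ico 0 T := Icc_subset_Ico_right hsT
  have hc : ContinuousOn (fun τ => D τ ^ 2 / m τ) (Icc 0 s) :=
    ((O.cont_D.mono hsub).pow 2).div (O.cont_m.mono hsub)
      fun τ hτ => (O.m_pos τ (hsub hτ) (hneg τ hτ)).ne'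
  have h2 : 0 < ∫ τ in (0 : ℝ)..s, D τ ^ 2 / m τ := by
    refine intervalIntegral.intervalIntegral_pos_of_pos_on
      (hc.intervalIntegrable_of_Icc hs.le) (fun τ hτ => ?_) hs
    have hτ' : τ ∈ Icc 0 s := Ioo_subset_Icc_self hτ
    exact div_pos (sq_pos_of_neg (hneg τ hτ')) (O.m_pos τ (hsub hτ') (hneg τ hτ'))
  linarith

/-- At a first zero `t` of `D`, the bound `D ≤ q (e - d)` passes to the limit from the left; since
energy has already been lost, its right side is strictly negative, a contradiction. -/
lemma neg (O : OutsideWell e m D d q T) (he : e 0 ≤ d) (hD : D 0 < 0) :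
    ∀ τ ∈ Ico 0 T, D τ < 0 := by
  by_contra! hcon
  obtain ⟨τ₁, hτ₁, hDτ₁⟩ := hcon
  have hsub : Icc 0 τ₁ ⊆ Ico 0 T := Icc_subset_Ico_right hτ₁.2
  have hcomp : IsCompact (Icc 0 τ₁ ∩ D ⁻¹' Ici 0) :=
    isCompact_Icc.of_isClosed_subset
      ((O.cont_D.mono hsub).preimage_isClosed_of_isClosed isClosed_Icc isClosed_Ici)
      inter_subset_left
  obtain ⟨t, ⟨ht, hDt⟩, hleast⟩ := hcomp.exists_isLeast ⟨τ₁, ⟨hτ₁.1, le_rfl⟩, hDτ₁⟩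
  have htT := hsub ht
  have hDt : 0 ≤ D t := hDt
  have ht0 : 0 < t := by
    refine lt_of_le_of_ne ht.1 ?_
    rintro rfl
    exact absurd hD (not_lt.2 hDt)
  have hbefore : ∀ τ ∈ Ico 0 t, D τ < 0 := by
    intro τ hτ
    by_contra hn
    exact absurd (hleast ⟨⟨hτ.1, hτ.2.le.trans ht.2⟩, not_lt.1 hn⟩) (not_le.2 hτ.2)
  -- Any time strictly inside `(0, t)` would do; it fixes a gap that persists up to `t`.
  have hhalf : e (t / 2) < e 0 := O.lt_initial (by linarith) (by linarith [htT.2])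
    fun τ hτ => hbefore τ ⟨hτ.1, by linarith [hτ.2]⟩
  have hle : D t ≤ q * (e (t / 2) - d) := by
    have hct : Tendsto D (𝓝[<] t) (𝓝 (D t)) :=
      (O.cont_D.continuousAt (Ico_mem_nhds ht0 htT.2)).tendsto.mono_left nhdsWithin_le_nhds
    refine le_of_tendsto hct ?_
    filter_upwards [Ioo_mem_nhdsLT (by linarith : t / 2 < t)] with τ hτ
    have hτ0 : 0 ≤ τ := by linarith [hτ.1]
    have hτT : τ < T := hτ.2.trans htT.2
    refine (O.le_of_neg τ ⟨hτ0, hτT⟩ (hbefore τ ⟨hτ0, hτ.2⟩)).trans ?_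
    have := O.antitone (by linarith : 0 ≤ t / 2) hτ.1.le hτT
    have := O.two_lt
    gcongr
  have : q * (e (t / 2) - d) < 0 :=
    mul_neg_of_pos_of_neg (by linarith [O.two_lt]) (by linarith)
  linarith

/-- The differential inequality `m' ≥ G(s) m(s)^(-q/2) m^(q/2)` with `G = 2q (d - e)`, which
expresses that `G m^(-q/2)` does not fall below its value at `s`. -/
lemma rpow_mul_le (O : OutsideWell e m D d q T) (hneg : ∀ τ ∈ Ico 0 T, D τ < 0) {s : ℝ}
    (hs : s ∈ Ioo 0 T) {t : ℝ} (ht : t ∈ Ico s T) :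
    2 * q * (d - e s) * m s ^ (-(q / 2)) * m t ^ (q / 2) ≤ -2 * D t := by
  have hq := O.two_lt
  set G : ℝ → ℝ := fun τ => 2 * q * (d - e τ) with hG
  have hst : Ico s T ⊆ Ioo 0 T := fun τ hτ => ⟨hs.1.trans_le hτ.1, hτ.2⟩
  have hmpos : ∀ τ ∈ Ioo 0 T, 0 < m τ := fun τ hτ =>
    O.m_pos τ (Ioo_subset_Ico_self hτ) (hneg τ (Ioo_subset_Ico_self hτ))
  have hGD : ∀ τ ∈ Ico 0 T, G τ ≤ -2 * D τ := fun τ hτ => by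
    have := O.le_of_neg τ hτ (hneg τ hτ)
    simp only [hG]; linarith
  set ψ : ℝ → ℝ := fun τ => q / 2 * (-2 * D τ / m τ) * G τ with hψ
  have hGc : ContinuousOn G (Ico 0 T) := continuousOn_const.mul (continuousOn_const.sub O.cont_e)
  have hψc : ContinuousOn ψ (Ioo 0 T) := by
    refine (continuousOn_const.mul ((continuousOn_const.mul
      (O.cont_D.mono Ioo_subset_Ico_self)).div (O.cont_m.mono Ioo_subset_Ico_self)
        fun τ hτ => (hmpos τ hτ).ne')).mul (hGc.mono Ioo_subset_Ico_self)
  have hint : ∀ τ ∈ Ioo 0 T, IntervalIntegrable ψ volume s τ := fun τ hτ =>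
    (hψc.mono (ordConnected_Ioo.uIcc_subset hs hτ)).intervalIntegrable
  -- Dissipation is assumed only in integrated form, so `G` need not be differentiable. `I` is a
  -- differentiable minorant with `I s = G s` and `I' = (q/2) (m'/m) G`.
  set I : ℝ → ℝ := fun τ => G s + ∫ σ in s..τ, ψ σ with hI
  have hId : ∀ τ ∈ Ioo 0 T, HasDerivAt I (ψ τ) τ := fun τ hτ =>
    (intervalIntegral.integral_hasDerivAt_right (hint τ hτ)
      (hψc.stronglyMeasurableAtFilter isOpen_Ioo τ hτ)
      (hψc.continuousAt (Ioo_mem_nhds hτ.1 hτ.2))).const_add _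
  have hIG : ∀ τ ∈ Ico s T, I τ ≤ G τ := by
    intro τ hτ
    have h1 := O.dissipation s τ hs.1.le hτ.1 hτ.2
    have hsubc : Icc s τ ⊆ Ioo 0 T := fun σ hσ => hst ⟨hσ.1, hσ.2.trans_lt hτ.2⟩
    have h2 : ∫ σ in s..τ, ψ σ ≤ ∫ σ in s..τ, 2 * q * (D σ ^ 2 / m σ) := by
      refine intervalIntegral.integral_mono_on hτ.1 (hint τ (hst hτ)) ?_ fun σ hσ => ?_
      · refine ContinuousOn.intervalIntegrable_of_Icc hτ.1 ?_
        have hsub' := hsubc.trans Ioo_subset_Ico_self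
        exact continuousOn_const.mul (((O.cont_D.mono hsub').pow 2).div (O.cont_m.mono hsub')
          fun σ hσ => (hmpos σ (hsubc hσ)).ne')
      · have hσ' := hsubc hσ
        have a1 := hGD σ (Ioo_subset_Ico_self hσ')
        have a2 := hneg σ (Ioo_subset_Ico_self hσ')
        have a3 := hmpos σ hσ'
        have a4 : 0 ≤ q / 2 * (-2 * D σ / m σ) :=
          mul_nonneg (by linarith) (div_nonneg (by linarith) a3.le)
        calc ψ σ ≤ q / 2 * (-2 * D σ / m σ) * (-2 * D σ) := mul_le_mul_of_nonneg_left a1 a4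
          _ = _ := by field_simp
    rw [intervalIntegral.integral_const_mul] at h2
    have h3 := mul_le_mul_of_nonneg_left h1 (by linarith : 0 ≤ 2 * q)
    simp only [hI, hG]
    linarith
  set W : ℝ → ℝ := fun τ => I τ * m τ ^ (-(q / 2)) with hW
  have hWd : ∀ τ ∈ Ioo 0 T, HasDerivAt W (ψ τ * m τ ^ (-(q / 2)) +
      I τ * (-2 * D τ * (-(q / 2)) * m τ ^ (-(q / 2) - 1))) τ := fun τ hτ =>
    (hId τ hτ).mul ((O.deriv_m τ hτ).rpow_const (Or.inl (hmpos τ hτ).ne'))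
  have hmono : MonotoneOn W (Ico s T) := by
    refine monotoneOn_of_deriv_nonneg (convex_Ico s T)
      (fun τ hτ => (hWd τ (hst hτ)).continuousAt.continuousWithinAt)
      (fun τ hτ => (hWd τ (hst (interior_subset hτ))).differentiableAt.differentiableWithinAt) ?_
    intro τ hτ
    have hτ' := interior_subset hτ
    have hτ'' := hst hτ'
    rw [(hWd τ hτ'').deriv]
    have a2 := hneg τ (Ioo_subset_Ico_self hτ'')
    have a3 := hmpos τ hτ''
    have e1 : m τ ^ (-(q / 2)) = m τ ^ (-(q / 2) - 1) * m τ := by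
      rw [← Real.rpow_add_one a3.ne']; ring_nf
    -- The derivative of `I m^(-q/2)` carries the factor `G - I`, which is nonnegative.
    have e2 : ψ τ * m τ ^ (-(q / 2)) + I τ * (-2 * D τ * (-(q / 2)) * m τ ^ (-(q / 2) - 1)) =
        q / 2 * (-2 * D τ) * m τ ^ (-(q / 2) - 1) * (G τ - I τ) := by
      rw [e1]; simp only [hψ]; field_simp; ring
    rw [e2]
    have := hIG τ hτ'
    exact mul_nonneg (mul_nonneg (mul_nonneg (by linarith) (by linarith))
      (Real.rpow_nonneg a3.le _)) (by linarith)
  have hWst := hmono ⟨le_rfl, hs.2⟩ ht ht.1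
  have hmt := hmpos t (hst ht)
  have hIs : I s = 2 * q * (d - e s) := by simp [hI, hG]
  have hfin : W s * m t ^ (q / 2) ≤ I t := by
    refine (mul_le_mul_of_nonneg_right hWst (Real.rpow_nonneg hmt.le (q / 2))).trans (le_of_eq ?_)
    simp only [hW]
    rw [mul_assoc, ← Real.rpow_add hmt]
    simp
  simp only [hW, hIs] at hfin
  exact hfin.trans ((hIG t ht).trans (hGD t (Ioo_subset_Ico_self (hst ht))))

/-- The bound on the life span. -/
lemma sub_mul_le (O : OutsideWell e m D d q T) (hneg : ∀ τ ∈ Ico 0 T, D τ < 0) {s : ℝ}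
    (hs : s ∈ Ioo 0 T) {t : ℝ} (ht : t ∈ Ico s T) :
    (t - s) * ((q / 2 - 1) * (2 * q * (d - e s))) ≤ m s := by
  have hq := O.two_lt
  have hst : Ico s T ⊆ Ioo 0 T := fun τ hτ => ⟨hs.1.trans_le hτ.1, hτ.2⟩
  have hmpos : ∀ τ ∈ Ioo 0 T, 0 < m τ := fun τ hτ =>
    O.m_pos τ (Ioo_subset_Ico_self hτ) (hneg τ (Ioo_subset_Ico_self hτ))
  set G := 2 * q * (d - e s) with hG
  set c := G * m s ^ (-(q / 2)) with hc
  -- As `q/2 > 1`, `m^(1 - q/2)` stays positive yet decreases at least linearly, with slope `(q/2 -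
  -- 1) c`.
  have hd : ∀ τ ∈ Ioo 0 T, HasDerivAt (fun τ => m τ ^ (1 - q / 2) + τ * ((q / 2 - 1) * c))
      (-2 * D τ * (1 - q / 2) * m τ ^ (1 - q / 2 - 1) + 1 * ((q / 2 - 1) * c)) τ := fun τ hτ =>
    ((O.deriv_m τ hτ).rpow_const (Or.inl (hmpos τ hτ).ne')).add
      ((hasDerivAt_id τ).mul_const ((q / 2 - 1) * c))
  have hanti : AntitoneOn (fun τ => m τ ^ (1 - q / 2) + τ * ((q / 2 - 1) * c)) (Ico s T) := by
    refine antitoneOn_of_deriv_nonpos (convex_Ico s T)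
      (fun τ hτ => (hd τ (hst hτ)).continuousAt.continuousWithinAt)
      (fun τ hτ => (hd τ (hst (interior_subset hτ))).differentiableAt.differentiableWithinAt) ?_
    intro τ hτ
    have hτ' := interior_subset hτ
    have a3 := hmpos τ (hst hτ')
    rw [(hd τ (hst hτ')).deriv]
    have h1 := O.rpow_mul_le hneg hs hτ'
    rw [← hG, ← hc] at h1
    have h2 : c ≤ -2 * D τ * m τ ^ (-(q / 2)) := by
      have := mul_le_mul_of_nonneg_right h1 (Real.rpow_nonneg a3.le (-(q / 2)))
      rwa [mul_assoc, ← Real.rpow_add a3, add_neg_cancel, Real.rpow_zero, mul_one] at this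
    have h3 : m τ ^ (1 - q / 2 - 1) = m τ ^ (-(q / 2)) := by ring_nf
    rw [h3]
    nlinarith
  have h1 := hanti ⟨le_rfl, hs.2⟩ ht ht.1
  simp only at h1
  have hms := hmpos s hs
  have hmt : 0 ≤ m t ^ (1 - q / 2) := Real.rpow_nonneg (hmpos t (hst ht)).le _
  have h2 : (t - s) * ((q / 2 - 1) * c) ≤ m s ^ (1 - q / 2) := by linarith
  have h3 := mul_le_mul_of_nonneg_right h2 (Real.rpow_nonneg hms.le (q / 2))
  rw [← Real.rpow_add hms, sub_add_cancel, Real.rpow_one] at h3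
  have h4 : m s ^ (-(q / 2)) * m s ^ (q / 2) = 1 := by
    rw [← Real.rpow_add hms, neg_add_cancel, Real.rpow_zero]
  calc (t - s) * ((q / 2 - 1) * G)
      = (t - s) * ((q / 2 - 1) * G) * (m s ^ (-(q / 2)) * m s ^ (q / 2)) := by rw [h4, mul_one]
    _ = (t - s) * ((q / 2 - 1) * c) * m s ^ (q / 2) := by rw [hc]; ring
    _ ≤ m s := h3

end OutsideWell

end BlowUp

/-! ### Poincaré and Hardy inequalities with Gaussian weight. -/

section WeightedInequalities

open Filter Topology

variable {N : ℕ}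

/-- The divergence theorem for the vector field `u(y) y`. -/
lemma integral_dilation_eq_zero {u : E N → ℝ} (hu : ContDiff ℝ 1 u) (hc : HasCompactSupport u) :
    ∫ y, (N * u y + fderiv ℝ u y y) = 0 := by
  have hfc : Continuous (fderiv ℝ u) := hu.continuous_fderiv one_ne_zero
  have hcoord : ∀ i : Fin N, Continuous fun y : E N => y i := fun i =>
    (EuclideanSpace.proj (𝕜 := ℝ) i).continuous
  have hint : ∀ i : Fin N,
      Integrable (fun y : E N => y i * fderiv ℝ u y (EuclideanSpace.single i 1)) := fun i =>
    ((hcoord i).mul (hfc.clm_apply continuous_const)).integrable_of_hasCompactSupport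
      ((hc.fderiv_apply ℝ _).mul_left)
  have hui : Integrable u := hu.continuous.integrable_of_hasCompactSupport hc
  have hfd : ∀ (i : Fin N) (y v : E N), fderiv ℝ (fun y : E N => y i) y v = v i := fun i y v => by
    have : HasFDerivAt (fun y : E N => y i) (EuclideanSpace.proj (𝕜 := ℝ) i) y :=
      (EuclideanSpace.proj (𝕜 := ℝ) i).hasFDerivAt
    rw [this.fderiv]; rfl
  have hparts : ∀ i : Fin N,
      ∫ y : E N, y i * fderiv ℝ u y (EuclideanSpace.single i 1) = - ∫ y, u y := by
    intro i
    rw [integral_mul_fderiv_eq_neg_fderiv_mul_of_integrable (μ := volume)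
      (f := fun y : E N => y i) (g := u)]
    · simp [hfd]
    · simpa [hfd] using hui
    · exact hint i
    · exact ((hcoord i).mul hu.continuous).integrable_of_hasCompactSupport hc.mul_left
    · exact fun x _ => (EuclideanSpace.proj (𝕜 := ℝ) i).differentiableAt
    · exact fun x _ => hu.differentiable one_ne_zero x
  have hsum : ∀ y : E N, fderiv ℝ u y y =
      ∑ i, y i * fderiv ℝ u y (EuclideanSpace.single i 1) := by
    intro y
    have hy : y = ∑ i, y i • EuclideanSpace.single i (1 : ℝ) := by
      simpa using ((EuclideanSpace.basisFun (Fin N) ℝ).sum_repr y).symm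
    conv_lhs => rw [hy, map_sum]
    refine Finset.sum_congr rfl fun i _ => ?_
    rw [map_smul, smul_eq_mul, ← hy]
  simp only [hsum]
  rw [integral_add (hui.const_mul _) (integrable_finsetSum _ fun i _ => hint i),
    integral_finsetSum _ fun i _ => hint i, integral_const_mul]
  simp [hparts]

lemma K_pos (y : E N) : 0 < K y := Real.exp_pos _

lemma contDiff_K : ContDiff ℝ ∞ (K : E N → ℝ) :=
  Real.contDiff_exp.comp ((contDiff_norm_sq ℝ).div_const 4)

lemma continuous_K : Continuous (K : E N → ℝ) := contDiff_K.continuous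

lemma hasFDerivAt_exp_norm_sq (c : ℝ) (y : E N) :
    HasFDerivAt (fun y : E N => Real.exp (‖y‖ ^ 2 / c))
      ((Real.exp (‖y‖ ^ 2 / c) * (2 / c)) • innerSL ℝ y) y := by
  have h1 : HasFDerivAt (fun y : E N => ‖y‖ ^ 2) (2 • innerSL ℝ y) y :=
    (hasStrictFDerivAt_norm_sq y).hasFDerivAt
  have h2 := (h1.mul_const c⁻¹).exp
  simp only [← div_eq_mul_inv] at h2
  refine h2.congr_fderiv ?_
  ext v
  simp
  ring

lemma inner_gradient_self (φ : E N → ℝ) (y : E N) :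
    inner ℝ (gradient φ y) y = fderiv ℝ φ y y := inner_gradient_left

lemma continuous_gradient {φ : E N → ℝ} (hφ : ContDiff ℝ 1 φ) : Continuous (gradient φ) :=
  (InnerProductSpace.toDual ℝ (E N)).symm.continuous.comp (hφ.continuous_fderiv one_ne_zero)

lemma hasCompactSupport_gradient {φ : E N → ℝ} (hc : HasCompactSupport φ) :
    HasCompactSupport (gradient φ) :=
  (hc.fderiv ℝ).comp_left (g := (InnerProductSpace.toDual ℝ (E N)).symm) (map_zero _)

/-- Completing the square against the vector field `θ(y) y`. -/
lemma integral_gradient_sq_eq {φ θ : E N → ℝ} (hφ : ContDiff ℝ 1 φ) (hc : HasCompactSupport φ)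
    (hθ : ContDiff ℝ 1 θ) :
    Integrable (fun y => ‖gradient φ y + (θ y * φ y) • y‖ ^ 2 * K y) ∧
    Integrable (fun y => (N * θ y + θ y * ‖y‖ ^ 2 / 2 + fderiv ℝ θ y y - θ y ^ 2 * ‖y‖ ^ 2) *
        φ y ^ 2 * K y) ∧
    ∫ y, ‖gradient φ y‖ ^ 2 * K y = (∫ y, ‖gradient φ y + (θ y * φ y) • y‖ ^ 2 * K y) +
      ∫ y, (N * θ y + θ y * ‖y‖ ^ 2 / 2 + fderiv ℝ θ y y - θ y ^ 2 * ‖y‖ ^ 2) * φ y ^ 2 * K y := by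
  have cφ := hφ.continuous
  have cθ := hθ.continuous
  have cg := continuous_gradient hφ
  have cK : Continuous (K : E N → ℝ) := continuous_K
  have cdθ : Continuous fun y => fderiv ℝ θ y y :=
    (hθ.continuous_fderiv one_ne_zero).clm_apply continuous_id
  have sg := hasCompactSupport_gradient hc
  set u : E N → ℝ := fun y => θ y * φ y ^ 2 * K y with hu
  have hK1 : ContDiff ℝ 1 (K : E N → ℝ) := contDiff_K.of_le (by simp)
  have hu1 : ContDiff ℝ 1 u := (hθ.mul (hφ.pow 2)).mul hK1
  have huc : HasCompactSupport u := by
    refine hc.mono fun y hy => ?_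
    simp only [hu, Function.mem_support] at hy ⊢
    intro h0
    simp [h0] at hy
  have i1 : Integrable (fun y => ‖gradient φ y + (θ y * φ y) • y‖ ^ 2 * K y) := by
    refine Continuous.integrable_of_hasCompactSupport (by fun_prop) ?_
    refine HasCompactSupport.mul_right ?_
    have : HasCompactSupport fun y => gradient φ y + (θ y * φ y) • y :=
      sg.add (hc.mul_left.smul_right)
    exact this.comp_left (g := fun z => ‖z‖ ^ 2) (by simp)
  have i2 : Integrable (fun y => (N * θ y + θ y * ‖y‖ ^ 2 / 2 + fderiv ℝ θ y y -
      θ y ^ 2 * ‖y‖ ^ 2) * φ y ^ 2 * K y) := by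
    refine Continuous.integrable_of_hasCompactSupport (by fun_prop) ?_
    refine hc.mono fun y hy => ?_
    simp only [Function.mem_support] at hy ⊢
    intro h0
    simp [h0] at hy
  have i3 : Integrable (fun y => N * u y + fderiv ℝ u y y) := by
    refine ((hu1.continuous.integrable_of_hasCompactSupport huc).const_mul _).add ?_
    refine Continuous.integrable_of_hasCompactSupport
      ((hu1.continuous_fderiv one_ne_zero).clm_apply continuous_id) ?_
    refine (huc.fderiv ℝ).mono fun y hy => ?_
    simp only [Function.mem_support] at hy ⊢
    intro h0
    simp [h0] at hy
  refine ⟨i1, i2, ?_⟩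
  -- The last term is the divergence of `θ φ² K y`, which integrates to zero.
  have hpt : ∀ y, ‖gradient φ y‖ ^ 2 * K y = ‖gradient φ y + (θ y * φ y) • y‖ ^ 2 * K y +
      (N * θ y + θ y * ‖y‖ ^ 2 / 2 + fderiv ℝ θ y y - θ y ^ 2 * ‖y‖ ^ 2) * φ y ^ 2 * K y -
      (N * u y + fderiv ℝ u y y) := by
    intro y
    have d1 : HasFDerivAt θ (fderiv ℝ θ y) y := (hθ.differentiable one_ne_zero y).hasFDerivAt
    have d2 : HasFDerivAt φ (fderiv ℝ φ y) y := (hφ.differentiable one_ne_zero y).hasFDerivAt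
    have d3 : HasFDerivAt (K : E N → ℝ) ((K y * (2 / 4)) • innerSL ℝ y) y :=
      hasFDerivAt_exp_norm_sq 4 y
    have d4 : HasFDerivAt u _ y := (d1.mul (d2.pow 2)).mul d3
    have e1 : fderiv ℝ u y y = fderiv ℝ θ y y * φ y ^ 2 * K y +
        2 * θ y * φ y * fderiv ℝ φ y y * K y + θ y * φ y ^ 2 * K y * ‖y‖ ^ 2 / 2 := by
      rw [d4.fderiv]
      simp
      ring
    have e2 : ‖gradient φ y + (θ y * φ y) • y‖ ^ 2 = ‖gradient φ y‖ ^ 2 +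
        2 * (θ y * φ y) * fderiv ℝ φ y y + (θ y * φ y) ^ 2 * ‖y‖ ^ 2 := by
      rw [norm_add_sq_real, inner_smul_right, inner_gradient_self, norm_smul, mul_pow,
        Real.norm_eq_abs, sq_abs]
      ring
    rw [e1, e2, hu]
    ring
  have i12 : Integrable (fun y => ‖gradient φ y + (θ y * φ y) • y‖ ^ 2 * K y +
      (N * θ y + θ y * ‖y‖ ^ 2 / 2 + fderiv ℝ θ y y - θ y ^ 2 * ‖y‖ ^ 2) * φ y ^ 2 * K y) :=
    i1.add i2
  simp_rw [hpt]
  rw [integral_sub i12 i3, integral_dilation_eq_zero hu1 huc, sub_zero, integral_add i1 i2]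

lemma lintegral_wMeasure {F : E N → ℝ≥0∞} (hF : Measurable F) :
    ∫⁻ y, F y ∂(wMeasure N) = ∫⁻ y, ENNReal.ofReal (K y) * F y :=
  lintegral_withDensity_eq_lintegral_mul _ continuous_K.measurable.ennreal_ofReal hF

lemma lintegral_ofReal_wMeasure {F : E N → ℝ} (hF : Continuous F) (h0 : ∀ y, 0 ≤ F y)
    (hi : Integrable fun y => F y * K y) :
    ∫⁻ y, ENNReal.ofReal (F y) ∂(wMeasure N) = ENNReal.ofReal (∫ y, F y * K y) := by
  rw [lintegral_wMeasure hF.measurable.ennreal_ofReal, ofReal_integral_eq_lintegral_ofReal hi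
    (Eventually.of_forall fun y => mul_nonneg (h0 y) (K_pos y).le)]
  refine lintegral_congr fun y => ?_
  rw [ENNReal.ofReal_mul (h0 y), mul_comm]

lemma enorm_sq_eq_ofReal {Z : Type*} [NormedAddCommGroup Z] (z : Z) :
    ‖z‖ₑ ^ 2 = ENNReal.ofReal (‖z‖ ^ 2) := by
  rw [← ofReal_norm, ENNReal.ofReal_pow (norm_nonneg z)]

lemma integrable_gradient_sq {φ : E N → ℝ} (hφ : ContDiff ℝ 1 φ) (hc : HasCompactSupport φ) :
    Integrable fun y => ‖gradient φ y‖ ^ 2 * K y := by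
  simpa using (integral_gradient_sq_eq hφ hc (contDiff_const (c := (0 : ℝ)))).1

/-- A lower bound `ρ` of the potential generated by `θ` yields a weighted `L²` inequality. -/
lemma lintegral_mul_sq_le {φ θ ρ : E N → ℝ} (hφ : ContDiff ℝ 1 φ) (hc : HasCompactSupport φ)
    (hθ : ContDiff ℝ 1 θ) (hρ : Continuous ρ) (hρ0 : ∀ y, 0 ≤ ρ y)
    (hρθ : ∀ y, ρ y ≤ N * θ y + θ y * ‖y‖ ^ 2 / 2 + fderiv ℝ θ y y - θ y ^ 2 * ‖y‖ ^ 2) :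
    ∫⁻ y, ENNReal.ofReal (ρ y) * ‖φ y‖ₑ ^ 2 ∂(wMeasure N) ≤
      ∫⁻ y, ‖gradient φ y‖ₑ ^ 2 ∂(wMeasure N) := by
  obtain ⟨j1, j2, heq⟩ := integral_gradient_sq_eq hφ hc hθ
  have cφ := hφ.continuous
  have cK : Continuous (K : E N → ℝ) := continuous_K
  have cg := continuous_gradient hφ
  have i1 : Integrable fun y => ρ y * ‖φ y‖ ^ 2 * K y := by
    refine Continuous.integrable_of_hasCompactSupport (by fun_prop) ?_
    refine hc.mono fun y hy => ?_
    simp only [Function.mem_support] at hy ⊢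
    intro h0
    simp [h0] at hy
  simp only [enorm_sq_eq_ofReal, ← ENNReal.ofReal_mul (hρ0 _)]
  rw [lintegral_ofReal_wMeasure (by fun_prop) (fun y => mul_nonneg (hρ0 y) (sq_nonneg _)) i1,
    lintegral_ofReal_wMeasure (by fun_prop) (fun y => sq_nonneg _) (integrable_gradient_sq hφ hc)]
  refine ENNReal.ofReal_le_ofReal ?_
  rw [heq]
  have h1 : 0 ≤ ∫ y, ‖gradient φ y + (θ y * φ y) • y‖ ^ 2 * K y :=
    integral_nonneg fun y => mul_nonneg (sq_nonneg _) (K_pos y).le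
  have h2 : ∫ y, ρ y * ‖φ y‖ ^ 2 * K y ≤ ∫ y, (N * θ y + θ y * ‖y‖ ^ 2 / 2 + fderiv ℝ θ y y -
      θ y ^ 2 * ‖y‖ ^ 2) * φ y ^ 2 * K y := by
    refine integral_mono i1 j2 fun y => ?_
    have := K_pos y
    simp only [Real.norm_eq_abs, sq_abs]
    gcongr
    exact hρθ y
  linarith

/-- The weighted Poincaré inequality. -/
lemma poincare_test {φ : E N → ℝ} (hφ : ContDiff ℝ 1 φ) (hc : HasCompactSupport φ) :
    ∫⁻ y, ENNReal.ofReal (N / 2) * ‖φ y‖ₑ ^ 2 ∂(wMeasure N) ≤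
      ∫⁻ y, ‖gradient φ y‖ₑ ^ 2 ∂(wMeasure N) := by
  -- For `θ = 1/2` the terms in `‖y‖²` cancel.
  refine lintegral_mul_sq_le (θ := fun _ => 1 / 2) (ρ := fun _ => N / 2) hφ hc contDiff_const
    continuous_const (fun y => by positivity) fun y => le_of_eq ?_
  simp
  ring

/-- The field combines the Hardy multiplier `((N - 2)/2) / |y|²`, regularized at the origin by `ε`,
with the constant `1/4`, which exploits the weight and yields the extra `N / 4`. -/
lemma hardy_test_regularized (hN : 3 ≤ N) {φ : E N → ℝ} (hφ : ContDiff ℝ 1 φ)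
    (hc : HasCompactSupport φ) {ε : ℝ} (hε : 0 < ε) :
    ∫⁻ y, ENNReal.ofReal (N / 4 + ((N : ℝ) - 2) ^ 2 / 4 / (‖y‖ ^ 2 + ε)) * ‖φ y‖ₑ ^ 2 ∂(wMeasure N) ≤
      ∫⁻ y, ‖gradient φ y‖ₑ ^ 2 ∂(wMeasure N) := by
  have hpos : ∀ y : E N, 0 < ‖y‖ ^ 2 + ε := fun y => by positivity
  have hN' : (3 : ℝ) ≤ N := by exact_mod_cast hN
  set l : ℝ := ((N : ℝ) - 2) / 2 with hl
  have hs : ContDiff ℝ 1 fun y : E N => ‖y‖ ^ 2 + ε := (contDiff_norm_sq ℝ).add contDiff_const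
  refine lintegral_mul_sq_le (θ := fun y => 1 / 4 + l * (‖y‖ ^ 2 + ε)⁻¹)
    (ρ := fun y => N / 4 + ((N : ℝ) - 2) ^ 2 / 4 / (‖y‖ ^ 2 + ε)) hφ hc
    (contDiff_const.add (contDiff_const.mul (hs.inv fun y => (hpos y).ne'))) ?_
    (fun y => ?_) fun y => ?_
  · exact continuous_const.add (continuous_const.div hs.continuous fun y => (hpos y).ne')
  · have := hpos y
    positivity
  · have h1 : HasFDerivAt (fun y : E N => ‖y‖ ^ 2 + ε) (2 • innerSL ℝ y) y :=
      (hasStrictFDerivAt_norm_sq y).hasFDerivAt.add_const ε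
    have h2 := (((hasDerivAt_inv (hpos y).ne').comp_hasFDerivAt y h1).const_mul l).const_add (1 / 4)
    have h3 : fderiv ℝ (fun y : E N => 1 / 4 + l * (‖y‖ ^ 2 + ε)⁻¹) y y =
        -(2 * l * ‖y‖ ^ 2 / (‖y‖ ^ 2 + ε) ^ 2) := by
      have h4 := h2.fderiv
      simp only [Function.comp_def] at h4
      rw [h4]
      simp
      ring
    rw [h3]
    set r := ‖y‖ ^ 2 with hr
    have hr0 : 0 ≤ r := sq_nonneg _
    have hR : 0 < r + ε := hpos y
    have hl0 : 0 ≤ l := by rw [hl]; linarith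
    have hNl : (N : ℝ) = 2 * l + 2 := by rw [hl]; ring
    -- The surplus over `ρ` in closed form, visibly nonnegative.
    have key : N * (1 / 4 + l * (r + ε)⁻¹) + (1 / 4 + l * (r + ε)⁻¹) * r / 2 +
        -(2 * l * r / (r + ε) ^ 2) - (1 / 4 + l * (r + ε)⁻¹) ^ 2 * r -
        (N / 4 + ((N : ℝ) - 2) ^ 2 / 4 / (r + ε)) =
        r / 16 + (2 * l + l ^ 2) * ε / (r + ε) ^ 2 := by
      rw [hNl]
      field_simp
      ring
    have : 0 ≤ r / 16 + (2 * l + l ^ 2) * ε / (r + ε) ^ 2 := by positivity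
    linarith

/-- The weighted Hardy inequality. -/
lemma hardy_test (hN : 3 ≤ N) {φ : E N → ℝ} (hφ : ContDiff ℝ 1 φ) (hc : HasCompactSupport φ) :
    ∫⁻ y, ENNReal.ofReal (N / 4 + ((N : ℝ) - 2) ^ 2 / 4 / ‖y‖ ^ 2) * ‖φ y‖ₑ ^ 2 ∂(wMeasure N) ≤
      ∫⁻ y, ‖gradient φ y‖ₑ ^ 2 ∂(wMeasure N) := by
  set ε : ℕ → ℝ := fun k => 1 / ((k : ℝ) + 1) with hε
  have hε0 : ∀ k, 0 < ε k := fun k => by positivity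
  have hlim : Tendsto ε atTop (𝓝 0) := tendsto_one_div_add_atTop_nhds_zero_nat
  set F : ℕ → E N → ℝ≥0∞ := fun k y =>
    ENNReal.ofReal (N / 4 + ((N : ℝ) - 2) ^ 2 / 4 / (‖y‖ ^ 2 + ε k)) * ‖φ y‖ₑ ^ 2 with hF
  have hmeas : ∀ k, Measurable (F k) := fun k => by
    have h1 : Measurable fun y : E N => N / 4 + ((N : ℝ) - 2) ^ 2 / 4 / (‖y‖ ^ 2 + ε k) :=
      measurable_const.add (measurable_const.div ((measurable_norm.pow_const 2).add_const _))
    exact h1.ennreal_ofReal.mul (hφ.continuous.measurable.enorm.pow_const 2)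
  have hpt : ∀ y, ENNReal.ofReal (N / 4 + ((N : ℝ) - 2) ^ 2 / 4 / ‖y‖ ^ 2) * ‖φ y‖ₑ ^ 2 ≤
      liminf (fun k => F k y) atTop := by
    intro y
    -- At the origin the quotient by `‖y‖ ^ 2` is `0` by convention, so only `N / 4` has to be
    -- dominated there.
    rcases eq_or_ne y 0 with rfl | hy
    · refine le_liminf_of_le (by isBoundedDefault) (Eventually.of_forall fun k => ?_)
      simp only [hF]
      gcongr ENNReal.ofReal ?_ * _
      have := hε0 k
      simp only [norm_zero, ne_eq, OfNat.ofNat_ne_zero, not_false_eq_true, zero_pow, div_zero,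
        zero_add, add_zero, le_add_iff_nonneg_right]
      positivity
    · have hy' : ‖y‖ ^ 2 ≠ 0 := by simpa using hy
      have t1 : Tendsto (fun k => N / 4 + ((N : ℝ) - 2) ^ 2 / 4 / (‖y‖ ^ 2 + ε k)) atTop
          (𝓝 (N / 4 + ((N : ℝ) - 2) ^ 2 / 4 / ‖y‖ ^ 2)) := by
        have t0 : Tendsto (fun k => ‖y‖ ^ 2 + ε k) atTop (𝓝 (‖y‖ ^ 2)) := by
          simpa using hlim.const_add (‖y‖ ^ 2)
        exact (tendsto_const_nhds.div t0 hy').const_add _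
      have t2 : Tendsto (fun k => F k y) atTop
          (𝓝 (ENNReal.ofReal (N / 4 + ((N : ℝ) - 2) ^ 2 / 4 / ‖y‖ ^ 2) * ‖φ y‖ₑ ^ 2)) :=
        ENNReal.Tendsto.mul_const (ENNReal.tendsto_ofReal t1) (Or.inr (by simp))
      exact t2.liminf_eq.ge
  calc _ ≤ ∫⁻ y, liminf (fun k => F k y) atTop ∂(wMeasure N) := lintegral_mono hpt
    _ ≤ liminf (fun k => ∫⁻ y, F k y ∂(wMeasure N)) atTop := lintegral_liminf_le hmeas
    _ ≤ liminf (fun _ : ℕ => ∫⁻ y, ‖gradient φ y‖ₑ ^ 2 ∂(wMeasure N)) atTop :=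
        liminf_le_liminf (Eventually.of_forall fun k => hardy_test_regularized hN hφ hc (hε0 k))
    _ = _ := by simp

end WeightedInequalities

/-! ### Sobolev inequality and extension of the inequalities to `X`. -/

section Embeddings

open Filter Topology

variable {N : ℕ}

lemma two_lt_twoStar (hN : 3 ≤ N) : 2 < twoStar N := by
  have hN' : (3 : ℝ) ≤ N := by exact_mod_cast hN
  rw [twoStar, lt_div_iff₀ (by linarith)]
  linarith

/-- The weighted Sobolev inequality. -/
lemma sobolev_test (hN : 3 ≤ N) : ∃ C : ℝ≥0∞, C ≠ ⊤ ∧ ∀ φ : E N → ℝ, ContDiff ℝ 1 φ →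
    HasCompactSupport φ →
    eLpNorm φ (ENNReal.ofReal (twoStar N)) (wMeasure N) ≤ C * eLpNorm (gradient φ) 2 (wMeasure N) := by
  have hN' : (3 : ℝ) ≤ N := by exact_mod_cast hN
  have hq := two_lt_twoStar hN
  refine ⟨(eLpNormLESNormFDerivOfEqInnerConst (volume : Measure (E N)) ((2 : NNReal) : ℝ) : ℝ≥0∞),
    ENNReal.coe_ne_top, fun φ hφ hc => ?_⟩
  -- `κ` is the square root of `K`. The unweighted Sobolev inequality is applied to `φ κ`, whose
  -- gradient is `κ (∇φ + φ y / 4)`: the completed square for `θ = 1/4`, where the leftover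
  -- potential is nonnegative.
  set κ : E N → ℝ := fun y => Real.exp (‖y‖ ^ 2 / 8) with hκ
  have hκ0 : ∀ y, 0 < κ y := fun y => Real.exp_pos _
  have hκ2 : ∀ y, κ y ^ 2 = K y := fun y => by
    rw [hκ, K, ← Real.exp_nat_mul]; congr 1; push_cast; ring
  have hκd : ContDiff ℝ 1 κ := Real.contDiff_exp.comp ((contDiff_norm_sq ℝ).div_const 8)
  set ψ : E N → ℝ := fun y => φ y * κ y with hψ
  have hψd : ContDiff ℝ 1 ψ := hφ.mul hκd
  have hψc : HasCompactSupport ψ := hc.mul_right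
  have hsob := eLpNorm_le_eLpNorm_fderiv_of_eq_inner (volume : Measure (E N)) hψd hψc
    (p := 2) (p' := (twoStar N).toNNReal) (by norm_num) (by simp; omega) (by
      rw [Real.coe_toNNReal _ (by linarith), finrank_euclideanSpace_fin, twoStar]
      have : (N : ℝ) - 2 ≠ 0 := by linarith
      push_cast
      field_simp)
  have hfd : ∀ y, ‖fderiv ℝ ψ y‖ ^ 2 = ‖gradient φ y + ((1 / 4) * φ y) • y‖ ^ 2 * K y := by
    intro y
    have d1 : HasFDerivAt φ (fderiv ℝ φ y) y := (hφ.differentiable one_ne_zero y).hasFDerivAt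
    have d2 : HasFDerivAt ψ _ y := d1.mul (hasFDerivAt_exp_norm_sq 8 y)
    have e1 : fderiv ℝ ψ y = κ y • (InnerProductSpace.toDual ℝ (E N))
        (gradient φ y + ((1 / 4) * φ y) • y) := by
      rw [d2.fderiv]
      ext v
      simp [hκ]
      ring
    rw [e1, norm_smul, LinearIsometryEquiv.norm_map, mul_pow, Real.norm_eq_abs, sq_abs, hκ2,
      mul_comm]
  have hgrad : eLpNorm (fderiv ℝ ψ) 2 volume ≤ eLpNorm (gradient φ) 2 (wMeasure N) := by
    rw [← ENNReal.pow_le_pow_left_iff two_ne_zero, eLpNorm_two_sq, eLpNorm_two_sq]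
    obtain ⟨j1, j2, heq⟩ := integral_gradient_sq_eq hφ hc (contDiff_const (c := (1 / 4 : ℝ)))
    simp only [enorm_sq_eq_ofReal, hfd]
    rw [lintegral_ofReal_wMeasure (F := fun y => ‖gradient φ y‖ ^ 2)
      ((continuous_gradient hφ).norm.pow 2) (fun y => sq_nonneg _)
      (integrable_gradient_sq hφ hc), ← ofReal_integral_eq_lintegral_ofReal j1
        (Eventually.of_forall fun y => mul_nonneg (sq_nonneg _) (K_pos y).le)]
    refine ENNReal.ofReal_le_ofReal ?_
    rw [heq]
    refine le_add_of_nonneg_right (integral_nonneg fun y => ?_)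
    have h1 := K_pos y
    have h2 : 0 ≤ (N : ℝ) * (1 / 4) + 1 / 4 * ‖y‖ ^ 2 / 2 +
        (fderiv ℝ (fun _ : E N => (1 / 4 : ℝ)) y) y - (1 / 4) ^ 2 * ‖y‖ ^ 2 := by
      simp only [fderiv_fun_const, Pi.zero_apply, _root_.zero_apply]
      nlinarith [sq_nonneg ‖y‖]
    positivity
  have hleft : eLpNorm φ (ENNReal.ofReal (twoStar N)) (wMeasure N) ≤
      eLpNorm ψ (ENNReal.ofReal (twoStar N)) volume := by
    rw [← ENNReal.rpow_le_rpow_iff (by linarith : 0 < twoStar N), ← eLpNorm_ofReal_rpow hq,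
      ← eLpNorm_ofReal_rpow hq,
      lintegral_wMeasure (hφ.continuous.measurable.enorm.pow_const _)]
    refine lintegral_mono fun y => ?_
    simp only [hψ]
    rw [enorm_mul, ENNReal.mul_rpow_of_nonneg _ _ (by linarith), mul_comm]
    gcongr
    rw [Real.enorm_of_nonneg (hκ0 y).le, ENNReal.ofReal_rpow_of_pos (hκ0 y)]
    refine ENNReal.ofReal_le_ofReal ?_
    -- Since `κ ≥ 1` and `2* > 2`, the weight satisfies `K = κ² ≤ κ^(2*)`.
    have h1 : 1 ≤ κ y := Real.one_le_exp (by positivity)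
    rw [← hκ2, ← Real.rpow_natCast]
    exact Real.rpow_le_rpow_of_exponent_le h1 (by push_cast; linarith)
  exact hleft.trans (hsob.trans (by gcongr; exact hgrad))

/-- Inequalities for test functions which are lower semicontinuous extend to `X`. -/
lemma lintegral_fn_le_of_test {ρ : E N → ℝ≥0∞} (hρ : Measurable ρ) {q : ℝ} {C : ℝ≥0∞}
    (hC : C ≠ ⊤) (h : ∀ φ : E N → ℝ, ContDiff ℝ 1 φ → HasCompactSupport φ →
      ∫⁻ y, ρ y * ‖φ y‖ₑ ^ q ∂(wMeasure N) ≤ C * eLpNorm (gradient φ) 2 (wMeasure N) ^ q) (v : X N)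
    (hρt : ∀ y, ρ y ≠ ⊤) :
    ∫⁻ y, ρ y * ‖fn v y‖ₑ ^ q ∂(wMeasure N) ≤ C * ‖grad v‖ₑ ^ q := by
  have hv : (v : L2K N × L2KVec N) ∈ closure (testPairs N : Set (L2K N × L2KVec N)) := v.2
  obtain ⟨z, hz, hlim⟩ := mem_closure_iff_seq_limit.1 hv
  have h1 : Tendsto (fun k => (z k).1) atTop (𝓝 (fn v)) := (continuous_fst.tendsto _).comp hlim
  have h2 : Tendsto (fun k => (z k).2) atTop (𝓝 (grad v)) := (continuous_snd.tendsto _).comp hlim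
  obtain ⟨ns, hns, hae⟩ := (tendstoInMeasure_of_tendsto_Lp h1).exists_seq_tendsto_ae
  have hbound : ∀ k, ∫⁻ y, ρ y * ‖(z k).1 y‖ₑ ^ q ∂(wMeasure N) ≤ C * ‖(z k).2‖ₑ ^ q := by
    intro k
    obtain ⟨φ, hφ, hφc, e1, e2⟩ := hz k
    have := h φ (hφ.of_le (by simp)) hφc
    rw [← eLpNorm_congr_ae e2] at this
    refine le_trans (le_of_eq (lintegral_congr_ae ?_)) (this.trans (le_of_eq ?_))
    · filter_upwards [e1] with y hy
      rw [hy]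
    · rw [Lp.enorm_def]
  calc ∫⁻ y, ρ y * ‖fn v y‖ₑ ^ q ∂(wMeasure N)
      ≤ ∫⁻ y, liminf (fun k => ρ y * ‖(z (ns k)).1 y‖ₑ ^ q) atTop ∂(wMeasure N) := by
        refine lintegral_mono_ae ?_
        filter_upwards [hae] with y hy
        have t1 : Tendsto (fun k => ‖(z (ns k)).1 y‖ₑ ^ q) atTop (𝓝 (‖fn v y‖ₑ ^ q)) :=
          (ENNReal.continuous_rpow_const.tendsto _).comp hy.enorm
        exact (ENNReal.Tendsto.const_mul t1 (Or.inr (hρt y))).liminf_eq.ge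
    _ ≤ liminf (fun k => ∫⁻ y, ρ y * ‖(z (ns k)).1 y‖ₑ ^ q ∂(wMeasure N)) atTop :=
        lintegral_liminf_le' fun k => hρ.aemeasurable.mul
          ((Lp.aestronglyMeasurable (z (ns k)).1).enorm.pow_const q)
    _ ≤ liminf (fun k => C * ‖(z (ns k)).2‖ₑ ^ q) atTop :=
        liminf_le_liminf (Eventually.of_forall fun k => hbound _)
    _ = C * ‖grad v‖ₑ ^ q := by
        have t1 : Tendsto (fun k => ‖(z (ns k)).2‖ₑ ^ q) atTop (𝓝 (‖grad v‖ₑ ^ q)) :=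
          (ENNReal.continuous_rpow_const.tendsto _).comp (h2.comp hns.tendsto_atTop).enorm
        exact (ENNReal.Tendsto.const_mul t1 (Or.inr hC)).liminf_eq

lemma lintegral_mul_sq_fn_le_of_test {ρ : E N → ℝ} (hρ : Measurable ρ)
    (h : ∀ φ : E N → ℝ, ContDiff ℝ 1 φ → HasCompactSupport φ →
      ∫⁻ y, ENNReal.ofReal (ρ y) * ‖φ y‖ₑ ^ 2 ∂(wMeasure N) ≤
        ∫⁻ y, ‖gradient φ y‖ₑ ^ 2 ∂(wMeasure N)) (v : X N) :
    ∫⁻ y, ENNReal.ofReal (ρ y) * ‖fn v y‖ₑ ^ 2 ∂(wMeasure N) ≤ ‖grad v‖ₑ ^ 2 := by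
  have := lintegral_fn_le_of_test hρ.ennreal_ofReal (q := 2) (C := 1) (by simp)
    (fun φ hφ hc => by
      have h1 := h φ hφ hc
      rw [← eLpNorm_two_sq] at h1
      simpa using h1) v (by simp)
  simpa using this

lemma lintegral_fn_sq (v : X N) : ∫⁻ y, ‖fn v y‖ₑ ^ 2 ∂(wMeasure N) = ‖fn v‖ₑ ^ 2 := by
  rw [← eLpNorm_two_sq, Lp.enorm_def]

/-- The Poincaré inequality on `X`. -/
lemma poincare (v : X N) : N / 2 * ‖fn v‖ ^ 2 ≤ ‖grad v‖ ^ 2 := by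
  have h := lintegral_mul_sq_fn_le_of_test (ρ := fun _ => (N : ℝ) / 2) measurable_const
    (fun φ hφ hc => poincare_test hφ hc) v
  rw [lintegral_const_mul' _ _ ENNReal.ofReal_ne_top, lintegral_fn_sq, enorm_sq_eq_ofReal,
    enorm_sq_eq_ofReal, ← ENNReal.ofReal_mul (by positivity)] at h
  exact (ENNReal.ofReal_le_ofReal_iff (by positivity)).1 h

lemma lintegral_hardy_le (hN : 3 ≤ N) (v : X N) :
    ENNReal.ofReal (N / 4) * ‖fn v‖ₑ ^ 2 + ENNReal.ofReal (((N : ℝ) - 2) ^ 2 / 4) *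
      ∫⁻ y, ‖fn v y / ‖y‖‖ₑ ^ 2 ∂(wMeasure N) ≤ ‖grad v‖ₑ ^ 2 := by
  have hm : Measurable fun y : E N => (N : ℝ) / 4 + ((N : ℝ) - 2) ^ 2 / 4 / ‖y‖ ^ 2 :=
    measurable_const.add (measurable_const.div (measurable_norm.pow_const 2))
  have h := lintegral_mul_sq_fn_le_of_test hm (fun φ hφ hc => hardy_test hN hφ hc) v
  refine le_trans (le_of_eq ?_) h
  rw [← lintegral_fn_sq, ← lintegral_const_mul' _ _ ENNReal.ofReal_ne_top,
    ← lintegral_const_mul' _ _ ENNReal.ofReal_ne_top,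
    ← lintegral_add_left' (((Lp.aestronglyMeasurable (fn v)).enorm.pow_const 2).const_mul _)]
  refine lintegral_congr fun y => ?_
  simp only [enorm_sq_eq_ofReal]
  rw [← ENNReal.ofReal_mul (by positivity), ← ENNReal.ofReal_mul (by positivity),
    ← ENNReal.ofReal_mul (by positivity), ← ENNReal.ofReal_add (by positivity) (by positivity)]
  congr 1
  rw [norm_div, norm_norm, div_pow]
  ring

lemma memLp_div_norm (hN : 3 ≤ N) (v : X N) :
    MemLp (fun y => fn v y / ‖y‖) 2 (wMeasure N) := by
  have hN' : (3 : ℝ) ≤ N := by exact_mod_cast hN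
  refine ⟨((Lp.aestronglyMeasurable (fn v)).aemeasurable.div
    measurable_norm.aemeasurable).aestronglyMeasurable, ?_⟩
  have h := (le_add_self.trans (lintegral_hardy_le hN v)).trans_lt
    (ENNReal.pow_lt_top (enorm_lt_top (x := grad v)))
  rw [← eLpNorm_two_sq] at h
  have h2 : eLpNorm (fun y => fn v y / ‖y‖) 2 (wMeasure N) ^ 2 ≠ ⊤ := by
    intro htop
    rw [htop, ENNReal.mul_top] at h
    · exact lt_irrefl _ h
    · simp only [ne_eq, ENNReal.ofReal_eq_zero, not_le]
      nlinarith
  exact lt_top_iff_ne_top.2 fun h3 => h2 (by rw [h3]; simp)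

/-- The map `v ↦ v / |y|` on `X`. -/
def hardyFn (hN : 3 ≤ N) (v : X N) : L2K N := (memLp_div_norm hN v).toLp _

/-- The Hardy inequality on `X`. -/
lemma hardy (hN : 3 ≤ N) (v : X N) :
    N / 4 * ‖fn v‖ ^ 2 + ((N : ℝ) - 2) ^ 2 / 4 * ‖hardyFn hN v‖ ^ 2 ≤ ‖grad v‖ ^ 2 := by
  have h := lintegral_hardy_le hN v
  have e : ∫⁻ y, ‖fn v y / ‖y‖‖ₑ ^ 2 ∂(wMeasure N) = ‖hardyFn hN v‖ₑ ^ 2 := by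
    rw [← eLpNorm_two_sq, hardyFn, Lp.enorm_toLp]
  rw [e] at h
  simp only [enorm_sq_eq_ofReal] at h
  rw [← ENNReal.ofReal_mul (by positivity), ← ENNReal.ofReal_mul (by positivity),
    ← ENNReal.ofReal_add (by positivity) (by positivity)] at h
  exact (ENNReal.ofReal_le_ofReal_iff (by positivity)).1 h

lemma exists_sobolev (hN : 3 ≤ N) : ∃ C : ℝ, 0 ≤ C ∧ ∀ v : X N,
    eLpNorm (fn v) (ENNReal.ofReal (twoStar N)) (wMeasure N) ≤ ENNReal.ofReal (C * ‖grad v‖) := by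
  have hq := two_lt_twoStar hN
  have hq0 : 0 < twoStar N := by linarith
  obtain ⟨C, hC, h⟩ := sobolev_test hN
  refine ⟨C.toReal, ENNReal.toReal_nonneg, fun v => ?_⟩
  have := lintegral_fn_le_of_test (ρ := fun _ => 1) measurable_const
    (C := C ^ twoStar N) (ENNReal.rpow_ne_top_of_nonneg hq0.le hC) (fun φ hφ hc => by
      simp only [one_mul]
      rw [eLpNorm_ofReal_rpow hq, ← ENNReal.mul_rpow_of_nonneg _ _ hq0.le]
      exact ENNReal.rpow_le_rpow (h φ hφ hc) hq0.le) v (by simp)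
  simp only [one_mul] at this
  rw [eLpNorm_ofReal_rpow hq, ← ENNReal.mul_rpow_of_nonneg _ _ hq0.le,
    ENNReal.rpow_le_rpow_iff hq0] at this
  rwa [ENNReal.ofReal_mul ENNReal.toReal_nonneg, ENNReal.ofReal_toReal hC, ofReal_norm]

end Embeddings

/-! ### The Hardy form and its gradient-flow structure. -/

section Form

open Filter Topology

variable {N : ℕ}

/-- The product norm is a maximum, and by Poincaré with `N / 2 ≥ 1` the gradient component attains
it. -/
lemma norm_eq_norm_grad (hN : 3 ≤ N) (v : X N) : ‖v‖ = ‖grad v‖ := by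
  have hN' : (3 : ℝ) ≤ N := by exact_mod_cast hN
  have h1 : ‖fn v‖ ≤ ‖grad v‖ := by
    refine (pow_le_pow_iff_left₀ (norm_nonneg _) (by positivity) two_ne_zero).1 ?_
    have := poincare v
    nlinarith [sq_nonneg ‖fn v‖]
  exact max_eq_right h1

/-- The inclusion of `X` in `L²_K`. -/
def fnL (N : ℕ) : X N →L[ℝ] L2K N :=
  (ContinuousLinearMap.fst ℝ (L2K N) (L2KVec N)).comp (testPairs N).topologicalClosure.subtypeL

/-- The gradient as a continuous linear map. -/
def gradL (N : ℕ) : X N →L[ℝ] L2KVec N :=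
  (ContinuousLinearMap.snd ℝ (L2K N) (L2KVec N)).comp (testPairs N).topologicalClosure.subtypeL

lemma fnL_apply (v : X N) : fnL N v = fn v := rfl

lemma coeFn_fn_add (v w : X N) : fn (v + w) =ᵐ[wMeasure N] fun y => fn v y + fn w y :=
  Lp.coeFn_add (fn v) (fn w)

lemma coeFn_fn_smul (c : ℝ) (v : X N) : fn (c • v) =ᵐ[wMeasure N] fun y => c * fn v y :=
  Lp.coeFn_smul c (fn v)

/-- Multiplication by `1 / |y|`, from `X` to `L²_K`. -/
def hardyL (hN : 3 ≤ N) : X N →L[ℝ] L2K N :=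
  LinearMap.mkContinuous
    { toFun := hardyFn hN
      map_add' := fun v w => by
        rw [hardyFn, hardyFn, hardyFn, ← MemLp.toLp_add, MemLp.toLp_eq_toLp_iff]
        filter_upwards [coeFn_fn_add v w] with y hy
        simp [hy, add_div]
      map_smul' := fun c v => by
        rw [hardyFn, hardyFn, RingHom.id_apply, ← MemLp.toLp_const_smul, MemLp.toLp_eq_toLp_iff]
        filter_upwards [coeFn_fn_smul c v] with y hy
        simp [hy, mul_div_assoc] }
    2 (fun v => by
      have hN' : (3 : ℝ) ≤ N := by exact_mod_cast hN
      have h := hardy hN v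
      rw [norm_eq_norm_grad hN]
      change ‖hardyFn hN v‖ ≤ _
      refine (pow_le_pow_iff_left₀ (norm_nonneg _) (by positivity) two_ne_zero).1 ?_
      have h1 : (1 : ℝ) ≤ ((N : ℝ) - 2) ^ 2 := by nlinarith
      have h2 := mul_le_mul_of_nonneg_right h1 (sq_nonneg ‖hardyFn hN v‖)
      have h3 : 0 ≤ (N : ℝ) / 4 * ‖fn v‖ ^ 2 := by positivity
      rw [mul_pow]
      linarith)

lemma hardyL_apply (hN : 3 ≤ N) (v : X N) : hardyL hN v = hardyFn hN v := rfl

lemma coeFn_hardyL (hN : 3 ≤ N) (v : X N) :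
    hardyL hN v =ᵐ[wMeasure N] fun y => fn v y / ‖y‖ :=
  (memLp_div_norm hN v).coeFn_toLp

lemma memLp_twoStar (hN : 3 ≤ N) (v : X N) :
    MemLp (fn v) (ENNReal.ofReal (twoStar N)) (wMeasure N) :=
  ⟨Lp.aestronglyMeasurable _, ((exists_sobolev hN).choose_spec.2 v).trans_lt ENNReal.ofReal_lt_top⟩

/-- The bilinear form of the operator `-Δ - y·∇/2 - μ/|y|² - β`. -/
def hardyForm (hN : 3 ≤ N) (μ : ℝ) : X N →L[ℝ] X N →L[ℝ] ℝ :=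
  (innerSL ℝ).bilinearComp (gradL N) (gradL N) -
    μ • (innerSL ℝ).bilinearComp (hardyL hN) (hardyL hN) -
    beta N • (innerSL ℝ).bilinearComp (fnL N) (fnL N)

lemma hardyForm_apply (hN : 3 ≤ N) (μ : ℝ) (v w : X N) :
    hardyForm hN μ v w = inner ℝ (grad v) (grad w) -
      μ * inner ℝ (hardyL hN v) (hardyL hN w) - beta N * inner ℝ (fn v) (fn w) := rfl

/-- As `μ` is at most half the Hardy constant, half of the gradient term survives along with `N/8
‖v‖²`; by Poincaré, what remains of the `β` term costs at most a further quarter. -/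
lemma hardyForm_coercive (hN : 3 ≤ N) {μ : ℝ} (hμ : μ ∈ Icc (0 : ℝ) (((N : ℝ) - 2) ^ 2 / 8))
    (v : X N) : 1 / 4 * ‖v‖ ^ 2 ≤ hardyForm hN μ v v := by
  have hN' : (3 : ℝ) ≤ N := by exact_mod_cast hN
  rw [hardyForm_apply, real_inner_self_eq_norm_sq, real_inner_self_eq_norm_sq,
    real_inner_self_eq_norm_sq, norm_eq_norm_grad hN, beta]
  have h1 := hardy hN v
  have h2 := poincare v
  rw [← hardyL_apply] at h1
  have h3 := mul_le_mul_of_nonneg_right hμ.2 (sq_nonneg ‖hardyL hN v‖)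
  have h4 := sq_nonneg ‖fn v‖
  nlinarith

variable [Fact (1 ≤ ENNReal.ofReal (twoStar N))]

/-- The Sobolev embedding of `X` in `L^{2*}_K`. -/
def sobL (hN : 3 ≤ N) : X N →L[ℝ] Lp ℝ (ENNReal.ofReal (twoStar N)) (wMeasure N) :=
  LinearMap.mkContinuous
    { toFun := fun v => (memLp_twoStar hN v).toLp _
      map_add' := fun v w => by
        rw [← MemLp.toLp_add, MemLp.toLp_eq_toLp_iff]
        exact coeFn_fn_add v w
      map_smul' := fun c v => by
        rw [RingHom.id_apply, ← MemLp.toLp_const_smul, MemLp.toLp_eq_toLp_iff]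
        exact coeFn_fn_smul c v }
    (exists_sobolev hN).choose (fun v => by
      obtain ⟨h0, h⟩ := (exists_sobolev hN).choose_spec
      rw [norm_eq_norm_grad hN]
      change ‖(memLp_twoStar hN v).toLp _‖ ≤ _
      rw [Lp.norm_toLp]
      exact ENNReal.toReal_le_of_le_ofReal (by positivity) (h v))

lemma coeFn_sobL (hN : 3 ≤ N) (v : X N) : sobL hN v =ᵐ[wMeasure N] fn v :=
  (memLp_twoStar hN v).coeFn_toLp

/-- The gradient-flow structure of the problem. -/
def form (hN : 3 ≤ N) {μ : ℝ} (hμ : μ ∈ Icc (0 : ℝ) (((N : ℝ) - 2) ^ 2 / 8)) :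
    SemilinearForm (X N) (L2K N) where
  ι := fnL N
  a := hardyForm hN μ
  symm v w := by
    rw [hardyForm_apply, hardyForm_apply, real_inner_comm, real_inner_comm (hardyL hN v),
      real_inner_comm (fn v)]
  c := 1 / 4
  c_pos := by norm_num
  coercive := hardyForm_coercive hN hμ
  g v := (powDual (two_lt_twoStar hN) (sobL hN v)).comp (sobL hN)
  continuous_g := ((continuous_powDual (two_lt_twoStar hN)).comp (sobL hN).continuous).clm_comp
    continuous_const
  G v := powPrim (sobL hN v)
  convex v w := by
    have := powPrim_sub_le (two_lt_twoStar hN) (sobL hN v) (sobL hN w)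
    rwa [← map_sub] at this
  k v w := twoStar N *
    ∫ y, |sobL hN v y| ^ (twoStar N - 2) * sobL hN w y * sobL hN w y ∂(wMeasure N)
  g_sub_le v w := by
    have := powDual_sub_apply_le (two_lt_twoStar hN) (sobL hN v) (sobL hN w)
    rw [← map_sub, mul_add] at this
    exact this
  k_le v₀ := by
    have hq := two_lt_twoStar hN
    have hq0 : 0 < twoStar N := by linarith
    -- Chosen so that `2* · ε · (‖sobL‖² + 1) = 1/16`, which is `c / 4` for `c = 1/4`.
    set ε : ℝ := 1 / (16 * twoStar N * (‖sobL hN‖ ^ 2 + 1)) with hε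
    have hε0 : 0 < ε := by positivity
    obtain ⟨M, hM⟩ := eventually_integral_rpow_mul_sq_le hq (sobL hN v₀) hε0
    refine ⟨twoStar N * M, ?_⟩
    filter_upwards [((sobL hN).continuous.tendsto v₀).eventually hM] with v hv w
    have h1 := hv (sobL hN w) (fn w) (coeFn_sobL hN w)
    have h2 : ‖sobL hN w‖ ^ 2 ≤ (‖sobL hN‖ ^ 2 + 1) * ‖w‖ ^ 2 := by
      calc ‖sobL hN w‖ ^ 2 ≤ (‖sobL hN‖ * ‖w‖) ^ 2 := by gcongr; exact (sobL hN).le_opNorm w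
        _ ≤ _ := by rw [mul_pow]; gcongr; linarith
    calc twoStar N * ∫ y, |sobL hN v y| ^ (twoStar N - 2) * sobL hN w y * sobL hN w y ∂(wMeasure N)
        ≤ twoStar N * (ε * ((‖sobL hN‖ ^ 2 + 1) * ‖w‖ ^ 2) + M * ‖fn w‖ ^ 2) := by
          gcongr
          refine h1.trans ?_
          gcongr
      _ = _ := by
          rw [fnL_apply, hε]
          field_simp
          ring

end Form

/-! ### From weak solutions to the scalar argument. -/

section Main

open Filter Topology

variable {N : ℕ} {μ : ℝ}

lemma fact_one_le_twoStar (hN : 3 ≤ N) : Fact (1 ≤ ENNReal.ofReal (twoStar N)) :=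
  ⟨by rw [ENNReal.one_le_ofReal]; linarith [two_lt_twoStar hN]⟩

lemma integrable_fn_mul_fn (v w : X N) : Integrable (fun y => fn v y * fn w y) (wMeasure N) := by
  refine (L2.integrable_inner (𝕜 := ℝ) (fn w) (fn v)).congr (Eventually.of_forall fun y => ?_)
  simp

lemma inner_fn_fn (v w : X N) : inner ℝ (fn v) (fn w) = ∫ y, fn v y * fn w y ∂(wMeasure N) := by
  rw [L2.inner_def]
  exact integral_congr_ae (Eventually.of_forall fun y => by simp [mul_comm])

lemma inner_hardyL_ae (hN : 3 ≤ N) (v w : X N) :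
    (fun y => inner ℝ (hardyL hN v y) (hardyL hN w y)) =ᵐ[wMeasure N]
      fun y => fn v y / ‖y‖ ^ 2 * fn w y := by
  filter_upwards [coeFn_hardyL hN v, coeFn_hardyL hN w] with y h1 h2
  rw [h1, h2, real_inner_eq_re_inner]
  simp
  ring

lemma integrable_hardy (hN : 3 ≤ N) (v w : X N) :
    Integrable (fun y => fn v y / ‖y‖ ^ 2 * fn w y) (wMeasure N) :=
  (L2.integrable_inner (𝕜 := ℝ) (hardyL hN v) (hardyL hN w)).congr (inner_hardyL_ae hN v w)

lemma inner_hardyL (hN : 3 ≤ N) (v w : X N) :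
    inner ℝ (hardyL hN v) (hardyL hN w) = ∫ y, fn v y / ‖y‖ ^ 2 * fn w y ∂(wMeasure N) := by
  rw [L2.inner_def]
  exact integral_congr_ae (inner_hardyL_ae hN v w)

lemma A_eq (hN : 3 ≤ N) (v : X N) : A N μ v = hardyForm hN μ v v := by
  have i1 : Integrable (fun y => ‖grad v y‖ ^ 2) (wMeasure N) := by
    refine (L2.integrable_inner (𝕜 := ℝ) (grad v) (grad v)).congr (Eventually.of_forall fun y => ?_)
    exact real_inner_self_eq_norm_sq _
  have i2 := (integrable_hardy hN v v).const_mul μ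
  have i3 := (integrable_fn_mul_fn v v).const_mul (beta N)
  have e1 : inner ℝ (grad v) (grad v) = ∫ y, ‖grad v y‖ ^ 2 ∂(wMeasure N) := by
    rw [L2.inner_def]
    exact integral_congr_ae (Eventually.of_forall fun y => real_inner_self_eq_norm_sq _)
  have i12 : Integrable (fun y => ‖grad v y‖ ^ 2 - μ * (fn v y / ‖y‖ ^ 2 * fn v y)) (wMeasure N) :=
    i1.sub i2
  rw [hardyForm_apply, inner_hardyL, inner_fn_fn, e1, ← integral_const_mul, ← integral_const_mul,
    ← integral_sub i1 i2, ← integral_sub i12 i3, A]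
  refine integral_congr_ae (Eventually.of_forall fun y => ?_)
  simp only [sq_abs]
  ring

lemma pExp_sub_one (hN : 3 ≤ N) : pExp N - 1 = twoStar N - 2 ∧ 1 / (pExp N - 1) = beta N := by
  have hN' : (3 : ℝ) ≤ N := by exact_mod_cast hN
  have h2 : (N : ℝ) - 2 ≠ 0 := by linarith
  refine ⟨by rw [pExp]; ring, ?_⟩
  rw [pExp, beta, twoStar]
  have : 2 * (N : ℝ) / (N - 2) - 1 - 1 = 4 / (N - 2) := by field_simp; ring
  rw [this]
  field_simp

lemma continuousOn_of_grad (hN : 3 ≤ N) {v : ℝ → X N} {s : Set ℝ}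
    (h : ContinuousOn (fun τ => grad (v τ)) s) : ContinuousOn v s := by
  intro τ hτ
  have h1 := h τ hτ
  rw [ContinuousWithinAt, tendsto_iff_norm_sub_tendsto_zero] at h1 ⊢
  refine h1.congr fun σ => ?_
  rw [norm_eq_norm_grad hN]
  rfl

lemma A_nonneg (hN : 3 ≤ N) (hμ : μ ∈ Icc (0 : ℝ) (((N : ℝ) - 2) ^ 2 / 8))
    (v : X N) : 0 ≤ A N μ v := by
  rw [A_eq hN]
  exact le_trans (by positivity) (hardyForm_coercive hN hμ v)

lemma A_pos (hN : 3 ≤ N) (hμ : μ ∈ Icc (0 : ℝ) (((N : ℝ) - 2) ^ 2 / 8))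
    {v : X N} (h : v ≠ 0) : 0 < A N μ v := by
  rw [A_eq hN]
  have := norm_pos_iff.2 h
  exact lt_of_lt_of_le (by positivity) (hardyForm_coercive hN hμ v)

lemma A_smul (hN : 3 ≤ N) (c : ℝ) (v : X N) : A N μ (c • v) = c ^ 2 * A N μ v := by
  rw [A_eq hN, A_eq hN]
  simp only [map_smul, _root_.smul_apply, smul_eq_mul]
  ring

lemma B_smul {c : ℝ} (hc : 0 ≤ c) (v : X N) : B N (c • v) = c ^ twoStar N * B N v := by
  rw [B, B, ← integral_const_mul]
  refine integral_congr_ae ?_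
  filter_upwards [coeFn_fn_smul c v] with y hy
  rw [hy, abs_mul, abs_of_nonneg hc, Real.mul_rpow hc (abs_nonneg _)]

/-- Outside the well, `A` exceeds its minimum on the Nehari manifold. -/
lemma nehari_le_of_neg (hN : 3 ≤ N) (hμ : μ ∈ Icc (0 : ℝ) (((N : ℝ) - 2) ^ 2 / 8))
    {v : X N} (hD : nehari N μ v < 0) :
    nehari N μ v ≤ twoStar N * (energy N μ v - depth N μ) := by
  have hN' : (3 : ℝ) ≤ N := by exact_mod_cast hN
  have hq := two_lt_twoStar hN
  have hq0 : 0 < twoStar N := by linarith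
  have hv : v ≠ 0 := by
    rintro rfl
    have h1 : A N μ (0 : X N) = 0 := by simpa using A_smul (μ := μ) hN 0 (0 : X N)
    have h2 : B N (0 : X N) = 0 := by
      have := B_smul (N := N) le_rfl (0 : X N)
      simpa [Real.zero_rpow hq0.ne'] using this
    rw [nehari, h1, h2] at hD
    simp at hD
  have hA := A_pos hN hμ hv
  have hAB : A N μ v < B N v := by rw [nehari] at hD; linarith
  have hB : 0 < B N v := hA.trans hAB
  -- The root of `D(c v) = 0`, i.e. `c^(q-2) = A(v) / B(v)`; it is at most `1` because `D(v) < 0`.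
  set c : ℝ := (A N μ v / B N v) ^ (1 / (twoStar N - 2)) with hc
  have hratio : 0 < A N μ v / B N v := div_pos hA hB
  have hc0 : 0 < c := Real.rpow_pos_of_pos hratio _
  have hc1 : c ≤ 1 := Real.rpow_le_one hratio.le ((div_le_one hB).2 hAB.le)
    (one_div_nonneg.2 (by linarith))
  have hcq : c ^ twoStar N = c ^ 2 * (A N μ v / B N v) := by
    have h1 : c ^ (twoStar N - 2) = A N μ v / B N v := by
      rw [hc, ← Real.rpow_mul hratio.le, one_div_mul_cancel (by linarith), Real.rpow_one]
    rw [← h1, ← Real.rpow_natCast, ← Real.rpow_add hc0]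
    congr 1
    push_cast
    ring
  have hBc : B N (c • v) = c ^ 2 * A N μ v := by
    rw [B_smul hc0.le, hcq]
    field_simp
  have hmem : c • v ∈ nehariManifold N μ := by
    refine ⟨?_, smul_ne_zero hc0.ne' hv⟩
    rw [nehari, A_smul hN, hBc, sub_self]
  have hk : 0 < 1 / 2 - 1 / twoStar N := by
    have : 1 / twoStar N < 1 / 2 := one_div_lt_one_div_of_lt (by norm_num) hq
    linarith
  -- On the Nehari manifold the energy is `(1/2 - 1/q) A ≥ 0`; boundedness is what makes the real
  -- infimum `d` a lower bound.
  have hbdd : BddBelow (energy N μ '' nehariManifold N μ) := by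
    refine ⟨0, ?_⟩
    rintro _ ⟨w, ⟨hw, -⟩, rfl⟩
    have hw' : B N w = A N μ w := by rw [nehari] at hw; linarith
    rw [energy, hw', ← sub_mul]
    exact mul_nonneg hk.le (A_nonneg hN hμ w)
  have hdepth : depth N μ ≤ (1 / 2 - 1 / twoStar N) * A N μ v := by
    refine (csInf_le hbdd ⟨_, hmem, rfl⟩).trans ?_
    rw [energy, A_smul hN, hBc, ← sub_mul]
    refine mul_le_mul_of_nonneg_left ?_ hk.le
    exact mul_le_of_le_one_left hA.le (pow_le_one₀ hc0.le hc1)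
  have h3 := mul_le_mul_of_nonneg_left hdepth hq0.le
  have h4 : twoStar N * ((1 / 2 - 1 / twoStar N) * A N μ v) = (twoStar N / 2 - 1) * A N μ v := by
    field_simp
  have h5 : twoStar N * energy N μ v = twoStar N / 2 * A N μ v - B N v := by
    rw [energy]; field_simp
  rw [mul_sub, h5, nehari]
  linarith

variable [Fact (1 ≤ ENNReal.ofReal (twoStar N))]

lemma B_eq (hN : 3 ≤ N) (v : X N) :
    B N v = powDual (two_lt_twoStar hN) (sobL hN v) (sobL hN v) := by
  rw [powDual_self, B]
  refine integral_congr_ae ?_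
  filter_upwards [coeFn_sobL hN v] with y hy
  rw [hy]

lemma powPrim_sobL (hN : 3 ≤ N) (v : X N) : powPrim (sobL hN v) = 1 / twoStar N * B N v := by
  rw [B_eq hN, powDual_self, powPrim, integral_div]
  ring

lemma energy_eq (hN : 3 ≤ N) (hμ : μ ∈ Icc (0 : ℝ) (((N : ℝ) - 2) ^ 2 / 8))
    (v : X N) : energy N μ v = (form hN hμ).Φ v := by
  rw [energy, A_eq hN, SemilinearForm.Φ, form]
  simp only [powPrim_sobL]

lemma nehari_eq (hN : 3 ≤ N) (hμ : μ ∈ Icc (0 : ℝ) (((N : ℝ) - 2) ^ 2 / 8))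
    (v : X N) : nehari N μ v = (form hN hμ).n v v := by
  rw [nehari, A_eq hN, B_eq hN, SemilinearForm.n, form]
  rfl

lemma integral_nonlinearity (hN : 3 ≤ N) (hμ : μ ∈ Icc (0 : ℝ) (((N : ℝ) - 2) ^ 2 / 8))
    (v w : X N) :
    ∫ y, (|fn v y| ^ (pExp N - 1) * fn v y + μ * (fn v y / ‖y‖ ^ 2) + fn v y / (pExp N - 1)) *
      fn w y ∂(wMeasure N) = inner ℝ (grad v) (grad w) - (form hN hμ).n v w := by
  obtain ⟨hp, hβ⟩ := pExp_sub_one hN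
  have i1 := integrable_rpow_mul_mul (two_lt_twoStar hN) (sobL hN v) (sobL hN v) (sobL hN w)
  have i2 := (integrable_hardy hN v w).const_mul μ
  have i3 := (integrable_fn_mul_fn v w).const_mul (beta N)
  have i12 : Integrable (fun y => |sobL hN v y| ^ (twoStar N - 2) * sobL hN v y * sobL hN w y +
      μ * (fn v y / ‖y‖ ^ 2 * fn w y)) (wMeasure N) := i1.add i2
  have e1 : (form hN hμ).n v w = hardyForm hN μ v w -
      powDual (two_lt_twoStar hN) (sobL hN v) (sobL hN w) := rfl
  rw [e1, hardyForm_apply, inner_hardyL, inner_fn_fn, powDual_apply, ← integral_const_mul,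
    ← integral_const_mul]
  have e2 : ∀ a b c d : ℝ, a - (a - b - c - d) = d + b + c := fun a b c d => by ring
  rw [e2, ← integral_add i1 i2, ← integral_add i12 i3]
  refine integral_congr_ae ?_
  filter_upwards [coeFn_sobL hN v, coeFn_sobL hN w] with y h1 h2
  rw [h1, h2, hp, ← hβ, hp]
  ring

/-- A weak solution is a flow of the associated form. -/
lemma IsWeakSolution.exists_isFlow (hN : 3 ≤ N) 
    (hμ : μ ∈ Icc (0 : ℝ) (((N : ℝ) - 2) ^ 2 / 8)) {v₀ : X N} {v : ℝ → X N} {T : ℝ}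
    (hv : IsWeakSolution N μ v₀ v T) : ∃ f : ℝ → L2K N, (form hN hμ).IsFlow v f T := by
  obtain ⟨vs, hmem, hprim, heq⟩ := hv.equation
  have hc := continuousOn_of_grad hN hv.continuousOn
  -- The time derivative is extended by zero to the whole line, so that shifts and averages make
  -- sense, and is replaced by a strongly measurable representative.
  have hmem' : MemLp ((Ioo 0 T).indicator vs) 2 volume :=
    (memLp_indicator_iff_restrict measurableSet_Ioo).2 hmem
  set f := hmem'.1.mk _ with hf
  have hae : ∀ᵐ τ, τ ∈ Ioo 0 T → f τ = vs τ := by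
    filter_upwards [hmem'.1.ae_eq_mk] with τ h1 h2
    rw [hf, ← h1, indicator_of_mem h2]
  have hae' : ∀ s < T, ∀ᵐ τ, τ ∈ uIoc 0 s → 0 ≤ s → f τ = vs τ := fun s hs => by
    filter_upwards [hae] with τ h1 h2 h3
    rw [uIoc_of_le h3] at h2
    exact h1 ⟨h2.1, h2.2.trans_lt hs⟩
  have hfmem : MemLp f 2 volume := (memLp_congr_ae hmem'.1.ae_eq_mk).1 hmem'
  refine ⟨f, hc, hmem'.1.stronglyMeasurable_mk, hfmem, fun s hs => ?_, fun w s hs => ?_⟩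
  · change fn (v s) = fn (v 0) + _
    rw [hprim s hs, hv.initial]
    congr 1
    refine intervalIntegral.integral_congr_ae ?_
    filter_upwards [hae' s hs.2] with τ h1 h2
    rw [h1 h2 hs.1]
  · have hs' : s ∈ Ico 0 T := ⟨hs.1.le, hs.2⟩
    have h0 : (0 : ℝ) ∈ Ico 0 T := ⟨le_rfl, hv.pos⟩
    have hsub : uIcc 0 s ⊆ Ico 0 T := ordConnected_Ico.uIcc_subset h0 hs'
    have hnc : ContinuousOn (fun τ => (form hN hμ).n (v τ) w) (uIcc 0 s) :=
      (((form hN hμ).continuous_n.comp_continuousOn hc).clm_apply continuousOn_const).mono hsub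
    have hgc : ContinuousOn (fun τ => inner ℝ (grad (v τ)) (grad w)) (uIcc 0 s) :=
      (hv.continuousOn.mono hsub).inner continuousOn_const
    have hfi : IntervalIntegrable (fun τ => inner ℝ (f τ) (fn w)) volume 0 s := by
      have h1 : IntervalIntegrable f volume 0 s :=
        intervalIntegrable_iff.mpr <| ((hfmem.locallyIntegrable (by norm_num)).integrableOn_isCompact
          isCompact_uIcc).mono_set uIoc_subset_uIcc
      exact intervalIntegrable_clm_comp ((innerSL ℝ).flip (fn w)) h1
    have h1 := heq w s hs
    have h2 : ∫ τ in (0 : ℝ)..s, (inner ℝ (vs τ) (fn w) + inner ℝ (grad (v τ)) (grad w)) =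
        ∫ τ in (0 : ℝ)..s, (inner ℝ (f τ) (fn w) + inner ℝ (grad (v τ)) (grad w)) := by
      refine intervalIntegral.integral_congr_ae ?_
      filter_upwards [hae' s hs.2] with τ h3 h4
      rw [h3 h4 hs.1.le]
    simp only [integral_nonlinearity hN hμ] at h1
    rw [h2, intervalIntegral.integral_add hfi hgc.intervalIntegrable,
      intervalIntegral.integral_sub hgc.intervalIntegrable hnc.intervalIntegrable] at h1
    change ∫ τ in (0 : ℝ)..s, (inner ℝ (f τ) (fn w) + (form hN hμ).n (v τ) w) = 0
    rw [intervalIntegral.integral_add hfi hnc.intervalIntegrable]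
    linarith

lemma IsWeakSolution.outsideWell (hN : 3 ≤ N) 
    (hμ : μ ∈ Icc (0 : ℝ) (((N : ℝ) - 2) ^ 2 / 8)) {v₀ : X N} {v : ℝ → X N} {T : ℝ}
    (hv : IsWeakSolution N μ v₀ v T) :
    OutsideWell (fun τ => energy N μ (v τ)) (fun τ => ‖fn (v τ)‖ ^ 2) (fun τ => nehari N μ (v τ))
      (depth N μ) (twoStar N) T := by
  obtain ⟨f, F⟩ := hv.exists_isFlow hN hμ
  have hc : ContinuousOn v (Ico 0 T) := F.continuousOn
  have hDc : Continuous fun x : X N => nehari N μ x := by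
    simp only [nehari_eq hN hμ]
    exact (form hN hμ).continuous_n.clm_apply continuous_id
  have hEc : Continuous fun x : X N => energy N μ x := by
    simp only [energy_eq hN hμ]
    exact (form hN hμ).continuous_Φ
  have hmc : Continuous fun x : X N => ‖fn x‖ ^ 2 := (fnL N).continuous.norm.pow 2
  have hpos : ∀ x : X N, nehari N μ x < 0 → 0 < ‖fn x‖ ^ 2 := by
    intro x hx
    by_contra hn
    have h0 : fn x = 0 := by
      have : ‖fn x‖ ^ 2 = 0 := le_antisymm (not_lt.1 hn) (sq_nonneg _)
      simpa using this
    have hB : B N x = 0 := by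
      have hz : fn x =ᵐ[wMeasure N] 0 := h0 ▸ Lp.coeFn_zero ℝ 2 (wMeasure N)
      rw [B]
      refine integral_eq_zero_of_ae ?_
      filter_upwards [hz] with y hy
      rw [hy]
      simp [Real.zero_rpow (by linarith [two_lt_twoStar hN] : twoStar N ≠ 0)]
    have hA := A_nonneg hN hμ x
    rw [nehari, hB] at hx
    linarith
  refine ⟨two_lt_twoStar hN, hmc.comp_continuousOn hc, hEc.comp_continuousOn hc,
    hDc.comp_continuousOn hc, fun τ hτ => ?_, fun τ => sq_nonneg _, fun τ _ => hpos _,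
    fun s t hs hst ht => ?_, fun τ _ => nehari_le_of_neg hN hμ⟩
  · rw [nehari_eq hN hμ]
    exact F.hasDerivAt_norm_sq hτ
  · rw [energy_eq hN hμ, energy_eq hN hμ, F.energy_identity hs hst ht, neg_le_neg_iff]
    have hi : IntegrableOn (fun τ => ‖f τ‖ ^ 2) (Ioc s t) volume :=
      (F.memLp.integrable_norm_pow (by norm_num)).integrableOn
    rw [intervalIntegral.integral_of_le hst, intervalIntegral.integral_of_le hst]
    refine integral_mono_of_nonneg (Eventually.of_forall fun τ =>
      div_nonneg (sq_nonneg _) (sq_nonneg _)) hi ?_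
    filter_upwards [ae_restrict_mem measurableSet_Ioc, ae_restrict_of_ae F.ae_equation] with τ h1 h2
    -- Testing with `v τ` itself gives `(v_s, v)_K = -D`, and Cauchy–Schwarz turns this into `D² ≤
    -- ‖v_s‖² m`.
    have h3 := h2 ⟨hs.trans_lt h1.1, h1.2.trans_lt ht⟩ (v τ)
    rw [← nehari_eq hN hμ] at h3
    have h4 : |nehari N μ (v τ)| ≤ ‖f τ‖ * ‖fn (v τ)‖ := by
      have := abs_real_inner_le_norm (f τ) (fn (v τ))
      have h5 : inner ℝ (f τ) (fn (v τ)) = - nehari N μ (v τ) := by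
        change inner ℝ (f τ) (fn (v τ)) + _ = 0 at h3
        linarith
      rwa [h5, abs_neg] at this
    -- This form also covers `m = 0`, where the quotient is `0` by convention.
    refine div_le_of_le_mul₀ (sq_nonneg _) (sq_nonneg _) ?_
    rw [← mul_pow, ← sq_abs]
    gcongr

end Main

end HardyHeat

end

theorem theorem4p2 (N : ℕ) (hN : 3 ≤ N) (μ : ℝ) (hμ : μ ∈ Set.Icc (0 : ℝ) (((N : ℝ) - 2) ^ 2 / 8))
    (v₀ : HardyHeat.X N)
    (hE : HardyHeat.energy N μ v₀ = HardyHeat.depth N μ)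
    (hD : HardyHeat.nehari N μ v₀ < 0)
    (v : ℝ → HardyHeat.X N) (T : ℝ) (hv : HardyHeat.IsWeakSolution N μ v₀ v T) :
    HardyHeat.maximalExistenceTime N μ v₀ v T < ⊤ := by
  have := HardyHeat.fact_one_le_twoStar hN
  have hT := hv.pos
  have hq := HardyHeat.two_lt_twoStar hN
  have hneg : ∀ {v' : ℝ → HardyHeat.X N} {T' : ℝ}, HardyHeat.IsWeakSolution N μ v₀ v' T' →
      ∀ τ ∈ Set.Ico 0 T', HardyHeat.nehari N μ (v' τ) < 0 := fun h =>
    (h.outsideWell hN hμ).neg (by simp only [h.initial]; exact hE.le)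
      (by simp only [h.initial]; exact hD)
  -- A positive time within the original interval: every longer solution agrees with `v` there, so
  -- the energy gap and the bound `R` do not depend on the extension.
  set s : ℝ := T / 2 with hs
  have hsT : s ∈ Set.Ioo 0 T := ⟨by positivity, by linarith⟩
  have hgap : HardyHeat.energy N μ (v s) < HardyHeat.depth N μ := by
    have h1 := (hv.outsideWell hN hμ).lt_initial hsT.1 hsT.2
      fun τ hτ => hneg hv τ ⟨hτ.1, hτ.2.trans_lt hsT.2⟩
    rwa [hv.initial, hE] at h1
  set G : ℝ := (HardyHeat.twoStar N / 2 - 1) *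
    (2 * HardyHeat.twoStar N * (HardyHeat.depth N μ - HardyHeat.energy N μ (v s))) with hG
  have hG0 : 0 < G := mul_pos (by linarith) (mul_pos (by linarith) (by linarith))
  set R : ℝ := max T (s + ‖HardyHeat.fn (v s)‖ ^ 2 / G) with hR
  refine lt_of_le_of_lt (iSup₂_le fun T' hT' => ENNReal.ofReal_le_ofReal (?_ : T' ≤ R))
    ENNReal.ofReal_lt_top
  obtain ⟨v', hv', hEq⟩ := hT'
  rcases le_or_gt T' T with hle | hlt
  · exact hle.trans (le_max_left _ _)
  refine le_trans ?_ (le_max_right _ _)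
  have hvs : v' s = v s := hEq ⟨hsT.1.le, by rw [min_eq_left hlt.le]; exact hsT.2⟩
  -- The life-span estimate holds for each `t < T'`; the bound on `T'` follows by density.
  refine le_of_forall_lt_imp_le_of_dense fun t ht => ?_
  rcases le_or_gt t s with hts | hts
  · exact hts.trans (le_add_of_nonneg_right (by positivity))
  have key := (hv'.outsideWell hN hμ).sub_mul_le (hneg hv') ⟨hsT.1, hsT.2.trans hlt⟩
    (t := t) ⟨hts.le, ht⟩
  rw [hvs, ← hG] at key
  have := (le_div_iff₀ hG0).2 key
  linarith
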